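/- **Theorem (series decomposition of the completed indefinite zeta function).** Write $e(z)=e^{2\pi i z}$, $Q_\Lambda(v)=v^\top\Lambda v$ for a symmetric matrix $\Lambda$, and $\mathcal E(\alpha)=\int_0^\alpha e^{-\pi u^2}\,du$ for $\alpha\in\mathbb R$. Let $\Omega$ be a complex symmetric $g\times g$ matrix whose imaginary part $M=\operatorname{Im}(\Omega)$ (taken entrywise) has $g-1$ positive eigenvalues and one negative eigenvalue. Let $p,q\in\mathbb R^g$, and let $c_1,c_2\in\mathbb R^g$ be real cone parameters with $Q_M(c_1)<0$ and $Q_M(c_2)<0$ that lie in the same component of $\{v\in\mathbb R^g: Q_M(v)<0\}$, that is, $c_1^\top Mc_2<0$. For $z\in\mathbb C^g$ let $$\Theta^{c_1,c_2}(z;\Omega)=\sum_{n\in\mathbb Z^g}\left[\mathcal E\!\left(\frac{c_2^\top\operatorname{Im}(\Omega n+z)}{\sqrt{-\frac12c_2^\top Mc_2}}\right)-\mathcal E\!\left(\frac{c_1^\top\operatorname{Im}(\Omega n+z)}{\sqrt{-\frac12c_1^\top Mc_1}}\right)\right]e\!\left(\tfrac12 n^\top\Omega n+n^\top z\right)$$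 with positive square roots, let $\Theta^{c_1,c_2}_{p,q}(\Omega)=e\!\left(\frac12q^\top\Omega q+p^\top q\right)\Theta^{c_1,c_2}(p+\Omega q;\Omega)$, and let $$\widehat\zeta^{\,c_1,c_2}_{p,q}(\Omega,s)=\int_0^\infty\Theta^{c_1,c_2}_{p,q}(t\Omega)\,t^s\,\frac{dt}{t}$$ be the completed indefinite zeta function. Then, for every $s\in\mathbb C$ with $\operatorname{Re}(s)>g/2$, the integral and both kinds of series below converge absolutely, and $$\widehat\zeta^{\,c_1,c_2}_{p,q}(\Omega,s)=\pi^{-s}\Gamma(s)\,\zeta^{c_1,c_2}_{p,q}(\Omega,s)-\pi^{-(s+\frac12)}\Gamma\!\left(s+\tfrac12\right)\left(\xi^{c_2}_{p,q}(\Omega,s)-\xi^{c_1}_{p,q}(\Omega,s)\right),$$ where $$\zeta^{c_1,c_2}_{p,q}(\Omega,s)=\frac12\sum_{n\in\mathbb Z^g+q}\left(\operatorname{sgn}(c_2^\top Mn)-\operatorname{sgn}(c_1^\top Mn)\right)e(p^\top n)\,Q_{-i\Omega}(n)^{-s},$$ and, for $c\in\{c_1,c_2\}$, $$\xi^{c}_{p,q}(\Omega,s)=\frac1{2s}\sum_{n\in\mathbb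 Z^g+q}\operatorname{sgn}(c^\top Mn)\,e(p^\top n)\left(\frac{(c^\top Mn)^2}{-\frac12Q_M(c)}\right)^{-s}{}_2F_1\!\left(s,s+\tfrac12;s+1;\frac{Q_M(c)\,Q_{-i\Omega}(n)}{2\,(c^\top Mn)^2}\right).$$ Here $\operatorname{sgn}(0)=0$ and a summand whose sign factor is $0$ is read as $0$. Whenever $\operatorname{sgn}(c_1^\top Mn)\neq\operatorname{sgn}(c_2^\top Mn)$ for some $n\in\mathbb Z^g+q$, one has $\operatorname{Re}(Q_{-i\Omega}(n))>0$. Complex powers use the principal branch of the logarithm, and ${}_2F_1(a,b;c;\cdot)$ denotes the principal branch on $\mathbb C\setminus[1,\infty)$, i.e. the holomorphic continuation of the hypergeometric series from the unit disc. -/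

import Mathlib

open scoped Matrix

namespace IndefiniteZeta

noncomputable section

/-- `e(z) = exp(2πiz)`. -/
def e (z : ℂ) : ℂ := Complex.exp (2 * (Real.pi : ℂ) * Complex.I * z)

/-- The quadratic form `Q_Λ(v) = vᵀ Λ v` (without a factor `1/2`). -/
def quadForm {R : Type*} [CommRing R] {g : ℕ} (Λ : Matrix (Fin g) (Fin g) R) (v : Fin g → R) : R :=
  v ⬝ᵥ (Λ *ᵥ v)

/-- The entrywise imaginary part `M = Im(Ω)`. -/
def imPart {g : ℕ} (Ω : Matrix (Fin g) (Fin g) ℂ) : Matrix (Fin g) (Fin g) ℝ :=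
  Ω.map Complex.im

/-- The Siegel intermediate half-space of genus `g` and index `k`: complex symmetric matrices whose
imaginary part has `g - k` positive and `k` negative eigenvalues (with multiplicity). -/
def siegelIntermediate (g k : ℕ) : Set (Matrix (Fin g) (Fin g) ℂ) :=
  {Ω | Ω.IsSymm ∧ ∃ h : (imPart Ω).IsHermitian,
    Nat.card {i : Fin g // 0 < h.eigenvalues i} + k = g ∧
      Nat.card {i : Fin g // h.eigenvalues i < 0} = k}

/-- The incomplete Gaussian integral `∫₀^α exp(-π u²) du` for real `α`. -/
def incompleteGauss (α : ℝ) : ℝ := ∫ u in (0 : ℝ)..α, Real.exp (-Real.pi * u ^ 2)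

/-- `cᵀ Im(Ωn + z) / √(-½ cᵀ Im(Ω) c)` for a real cone parameter `c` with `cᵀ Im(Ω) c < 0`;
the square root is the positive one. -/
def thetaArg {g : ℕ} (c : Fin g → ℝ) (z : Fin g → ℂ) (Ω : Matrix (Fin g) (Fin g) ℂ)
    (n : Fin g → ℤ) : ℝ :=
  (c ⬝ᵥ fun i => ((Ω *ᵥ (fun j => (n j : ℂ)) + z) i).im) /
    Real.sqrt (-(1 / 2) * quadForm (imPart Ω) c)

/-- The indefinite theta function `Θ^{c₁,c₂}(z;Ω)` with real cone parameters. -/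
def theta {g : ℕ} (c₁ c₂ : Fin g → ℝ) (z : Fin g → ℂ) (Ω : Matrix (Fin g) (Fin g) ℂ) : ℂ :=
  ∑' n : Fin g → ℤ,
    ((incompleteGauss (thetaArg c₂ z Ω n) - incompleteGauss (thetaArg c₁ z Ω n) : ℝ) : ℂ) *
      e (1 / 2 * quadForm Ω (fun i => (n i : ℂ)) + (fun i => (n i : ℂ)) ⬝ᵥ z)

/-- The indefinite theta null with characteristics `Θ^{c₁,c₂}_{p,q}(Ω)`. -/
def thetaNull {g : ℕ} (c₁ c₂ p q : Fin g → ℝ) (Ω : Matrix (Fin g) (Fin g) ℂ) : ℂ :=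
  e (1 / 2 * quadForm Ω (fun i => (q i : ℂ)) + ((p ⬝ᵥ q : ℝ) : ℂ)) *
    theta c₁ c₂ ((fun i => (p i : ℂ)) + Ω *ᵥ (fun i => (q i : ℂ))) Ω

/-- The function `t ↦ Θ^{c₁,c₂}_{p,q}(tΩ)` of the real variable `t`. -/
def thetaRay {g : ℕ} (c₁ c₂ p q : Fin g → ℝ) (Ω : Matrix (Fin g) (Fin g) ℂ) (t : ℝ) : ℂ :=
  thetaNull c₁ c₂ p q ((t : ℂ) • Ω)

/-- The completed indefinite zeta function `∫₀^∞ Θ^{c₁,c₂}_{p,q}(tΩ) t^s dt/t`. -/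
def completedZeta {g : ℕ} (c₁ c₂ p q : Fin g → ℝ) (Ω : Matrix (Fin g) (Fin g) ℂ) (s : ℂ) : ℂ :=
  mellin (thetaRay c₁ c₂ p q Ω) s

/-- The point `m + q` of the shifted lattice `ℤ^g + q`. -/
def shift {g : ℕ} (q : Fin g → ℝ) (m : Fin g → ℤ) : Fin g → ℝ := fun i => (m i : ℝ) + q i

/-- `cᵀ M n`, where `M = Im(Ω)`. -/
def pairing {g : ℕ} (Ω : Matrix (Fin g) (Fin g) ℂ) (c n : Fin g → ℝ) : ℝ :=
  c ⬝ᵥ (imPart Ω *ᵥ n)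

/-- `Q_{-iΩ}(n)` for a real vector `n`. -/
def twistedForm {g : ℕ} (Ω : Matrix (Fin g) (Fin g) ℂ) (n : Fin g → ℝ) : ℂ :=
  quadForm ((-Complex.I) • Ω) (fun i => (n i : ℂ))

/-- The plane cut along `[1, ∞)`. -/
def cutPlane : Set ℂ := {z | 1 - z ∈ Complex.slitPlane}

/-- `f` is holomorphic on `ℂ ∖ [1, ∞)` and is the hypergeometric power series on the unit disc. -/
def IsHypergeometricBranch (a b c : ℂ) (f : ℂ → ℂ) : Prop :=
  DifferentiableOn ℂ f cutPlane ∧ ∀ z : ℂ, ‖z‖ < 1 → f z = ordinaryHypergeometric a b c z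

open scoped Classical in
/-- The principal branch of the Gauss hypergeometric function: the holomorphic continuation to
`ℂ ∖ [1, ∞)` of the hypergeometric series (`0` if there were none). -/
def hypergeometric (a b c z : ℂ) : ℂ :=
  if h : ∃ f, IsHypergeometricBranch a b c f then h.choose z else 0

/-- The principal branch is unique, so `hypergeometric` does not depend on any choice. -/
theorem IsHypergeometricBranch.hypergeometric_eq {a b c : ℂ} {f : ℂ → ℂ}
    (hf : IsHypergeometricBranch a b c f) {z : ℂ} (hz : z ∈ cutPlane) :
    hypergeometric a b c z = f z := by
  have hex : ∃ f, IsHypergeometricBranch a b c f := ⟨f, hf⟩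
  have hg := hex.choose_spec
  have hopen : IsOpen cutPlane :=
    Complex.isOpen_slitPlane.preimage (continuous_const.sub continuous_id)
  have h0 : (0 : ℂ) ∈ cutPlane := by simp [cutPlane]
  have hstar : StarConvex ℝ 0 cutPlane := by
    intro y hy u v hu hv huv
    have h1 := Complex.starConvex_one_slitPlane hy hu hv huv
    have h2 : 1 - (u • (0 : ℂ) + v • y) = u • (1 : ℂ) + v • (1 - y) := by
      have : (u : ℂ) + v = 1 := by exact_mod_cast huv
      simp only [Complex.real_smul]
      linear_combination -this
    show 1 - (u • (0 : ℂ) + v • y) ∈ Complex.slitPlane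
    rw [h2]
    exact h1
  have hconn : IsPreconnected cutPlane := (hstar.isPathConnected h0).isConnected.isPreconnected
  have hev : hex.choose =ᶠ[nhds 0] f := by
    filter_upwards [Metric.ball_mem_nhds (0 : ℂ) one_pos] with w hw
    have hw' : ‖w‖ < 1 := by simpa using hw
    rw [hg.2 w hw', hf.2 w hw']
  have := (hg.1.analyticOnNhd hopen).eqOn_of_preconnected_of_eventuallyEq
    (hf.1.analyticOnNhd hopen) hconn h0 hev hz
  rw [hypergeometric, dif_pos hex]
  exact this

/-- The summand of the incomplete indefinite zeta function at the lattice point `n = m + q`;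
it is `0` when the two signs agree. -/
def zetaTerm {g : ℕ} (c₁ c₂ p q : Fin g → ℝ) (Ω : Matrix (Fin g) (Fin g) ℂ) (s : ℂ)
    (m : Fin g → ℤ) : ℂ :=
  ((Real.sign (pairing Ω c₂ (shift q m)) - Real.sign (pairing Ω c₁ (shift q m)) : ℝ) : ℂ) *
    e ((p ⬝ᵥ shift q m : ℝ) : ℂ) * twistedForm Ω (shift q m) ^ (-s)

/-- The incomplete indefinite zeta function `ζ^{c₁,c₂}_{p,q}(Ω,s)`. -/
def incompleteZeta {g : ℕ} (c₁ c₂ p q : Fin g → ℝ) (Ω : Matrix (Fin g) (Fin g) ℂ) (s : ℂ) : ℂ :=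
  1 / 2 * ∑' m : Fin g → ℤ, zetaTerm c₁ c₂ p q Ω s m

/-- The summand of the correction series at the lattice point `n = m + q`, with `M = Im(Ω)`:
`sgn(cᵀMn) e(pᵀn) ((cᵀMn)² / (-½ Q_M(c)))^{-s}
  ₂F₁(s, s+½; s+1; Q_M(c) Q_{-iΩ}(n) / (2 (cᵀMn)²))`. It is `0` when `cᵀMn = 0`. -/
def xiTerm {g : ℕ} (c p q : Fin g → ℝ) (Ω : Matrix (Fin g) (Fin g) ℂ) (s : ℂ)
    (m : Fin g → ℤ) : ℂ :=
  (Real.sign (pairing Ω c (shift q m)) : ℂ) * e ((p ⬝ᵥ shift q m : ℝ) : ℂ) *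
    ((pairing Ω c (shift q m) ^ 2 / (-(1 / 2) * quadForm (imPart Ω) c) : ℝ) : ℂ) ^ (-s) *
    hypergeometric s (s + 1 / 2) (s + 1)
      (((quadForm (imPart Ω) c : ℝ) : ℂ) * twistedForm Ω (shift q m) /
        (2 * (pairing Ω c (shift q m) : ℂ) ^ 2))

/-- The correction series `ξ^c_{p,q}(Ω,s)`. -/
def xi {g : ℕ} (c p q : Fin g → ℝ) (Ω : Matrix (Fin g) (Fin g) ℂ) (s : ℂ) : ℂ :=
  1 / (2 * s) * ∑' m : Fin g → ℤ, xiTerm c p q Ω s m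

end

end IndefiniteZeta

open IndefiniteZeta

/-! Put n = m + q, α_c(n) = cᵀMn / √(-½ Q_M(c)) and T(x) = ∫_x^∞ exp(-πu²) du. On the ray tΩ the
theta summand at n is [ℰ(√t α_{c₂}(n)) - ℰ(√t α_{c₁}(n))] e(pᵀn) exp(-π Q_{-iΩ}(n) t). Since ℰ(x) =
sgn(x)/2 - sgn(x) T(|x|), it splits into a sign term and two tail terms
(`thetaRay_eq_tsum_rayTerms`), whose Mellin transforms are the summands of the zeta series and of
the two ξ series.

The sign term is a Gamma integral with complex rate (`integral_cpow_mul_exp_neg`). For a tail term,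
with α = |α_c(n)| and Q = Q_{-iΩ}(n), write T(√t α) = ∫_1^∞ √t α exp(-π t α² v²) dv and exchange
integrals. The t-integral is a Gamma integral at s + 1/2 with rate π(α²v² + Q), and the remaining
v-integral is Euler's integral for ₂F₁(s, s+½; s+1; -Q/α²) (`mellin_tailExp`).

Termwise integration rests on one bound: each of the three terms is at most exp(-πδ‖n‖²t) in modulus
(`exists_quadratic_lower_bound`). Indeed Re Q_{-iΩ} = Q_M. A sign term survives only if cᵢᵀMn, i =
1, 2, have product ≤ 0, and Q_M is positive there because M has a single negative direction. A tail
gains the factor exp(-π t α_c(n)²), and α_c² + Q_M is positive definite. The integrals of the moduli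
are then O(‖n‖^(-2 Re s)), summable over the lattice for Re s > g/2
(`hasSum_mellin_of_norm_le_exp`). -/

namespace IndefiniteZeta

open MeasureTheory Set Filter Topology Complex
open scoped Matrix

/-! ### Quadratic forms with one negative eigenvalue -/

section QuadraticForms

variable {g : ℕ} {M : Matrix (Fin g) (Fin g) ℝ}

theorem dotProduct_mulVec_comm_of_isSymm (hM : M.IsSymm) (x y : Fin g → ℝ) :
    x ⬝ᵥ (M *ᵥ y) = y ⬝ᵥ (M *ᵥ x) := by
  rw [Matrix.dotProduct_mulVec, ← Matrix.mulVec_transpose, hM.eq, dotProduct_comm]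

theorem quadForm_lin_comb (hM : M.IsSymm) (a b : ℝ) (x y : Fin g → ℝ) :
    quadForm M (a • x + b • y) =
      a ^ 2 * quadForm M x + 2 * a * b * (x ⬝ᵥ (M *ᵥ y)) + b ^ 2 * quadForm M y := by
  simp only [quadForm, Matrix.mulVec_add, Matrix.mulVec_smul, dotProduct_add, add_dotProduct,
    dotProduct_smul, smul_dotProduct, smul_eq_mul]
  rw [dotProduct_mulVec_comm_of_isSymm hM y x]
  ring

theorem quadForm_smul (a : ℝ) (x : Fin g → ℝ) :
    quadForm M (a • x) = a ^ 2 * quadForm M x := by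
  simp only [quadForm, Matrix.mulVec_smul, dotProduct_smul, smul_dotProduct, smul_eq_mul]
  ring

theorem continuous_quadForm (M : Matrix (Fin g) (Fin g) ℝ) : Continuous (quadForm M) :=
  continuous_id.dotProduct (continuous_const.matrix_mulVec continuous_id)

/-- A quadratic form with one negative eigenvalue and `g - 1` positive ones is positive definite on
a hyperplane. -/
theorem exists_functional_of_signature (h : M.IsHermitian)
    (hpos : Nat.card {i : Fin g // 0 < h.eigenvalues i} + 1 = g)
    (hneg : Nat.card {i : Fin g // h.eigenvalues i < 0} = 1) :
    ∃ u : Fin g → ℝ, ∀ v, v ≠ 0 → u ⬝ᵥ v = 0 → 0 < quadForm M v := by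
  classical
  obtain ⟨⟨i₀, hi₀⟩, huniq⟩ :=
    Fintype.card_eq_one_iff.mp (Nat.card_eq_fintype_card (α := {i // h.eigenvalues i < 0}) ▸ hneg)
  -- The g - 1 positive indices lie in the complement of `i₀`, which has exactly g - 1 elements, so
  -- they fill it.
  have hother : ∀ i, i ≠ i₀ → 0 < h.eigenvalues i := by
    have hsub : (Finset.univ.filter fun i => 0 < h.eigenvalues i) ⊆ Finset.univ.erase i₀ := by
      intro i hi
      simp only [Finset.mem_filter, Finset.mem_univ, true_and] at hi
      simp only [Finset.mem_erase, Finset.mem_univ, and_true]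
      rintro rfl
      exact lt_asymm hi hi₀
    have hcard : (Finset.univ.filter fun i => 0 < h.eigenvalues i).card + 1 = g := by
      rwa [Nat.card_eq_fintype_card, Fintype.card_subtype] at hpos
    have heq := Finset.eq_of_subset_of_card_le hsub (by
      rw [Finset.card_erase_of_mem (Finset.mem_univ _), Finset.card_univ, Fintype.card_fin]
      omega)
    intro i hi
    have : i ∈ Finset.univ.erase i₀ := by simp [hi]
    rw [← heq] at this
    simpa using this
  let U : Matrix (Fin g) (Fin g) ℝ := h.eigenvectorUnitary
  have hU : U * Uᵀ = 1 := by
    have := Unitary.mul_star_self_of_mem h.eigenvectorUnitary.2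
    simpa [U, Matrix.star_eq_conjTranspose,
      Matrix.conjTranspose_eq_transpose_of_trivial] using this
  have hspec : M = U * Matrix.diagonal h.eigenvalues * Uᵀ := by
    have := h.spectral_theorem
    rw [Unitary.conjStarAlgAut_apply] at this
    simpa [U, Matrix.star_eq_conjTranspose, Function.comp_def,
      Matrix.conjTranspose_eq_transpose_of_trivial] using this
  have hQ : ∀ v, quadForm M v = ∑ i, h.eigenvalues i * (Uᵀ *ᵥ v) i ^ 2 := by
    intro v
    have h1 : M *ᵥ v = U *ᵥ (Matrix.diagonal h.eigenvalues *ᵥ (Uᵀ *ᵥ v)) := by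
      conv_lhs => rw [hspec]
      simp [Matrix.mulVec_mulVec, Matrix.mul_assoc]
    rw [quadForm, h1, Matrix.dotProduct_mulVec, ← Matrix.mulVec_transpose]
    simp only [dotProduct, Matrix.mulVec_diagonal]
    exact Finset.sum_congr rfl fun i _ => by ring
  -- The functional is the eigenvector of the negative eigenvalue: on its kernel only positive
  -- eigenvalues contribute.
  refine ⟨fun j => U j i₀, fun v hv hu => ?_⟩
  have hi₀v : (Uᵀ *ᵥ v) i₀ = 0 := hu
  have hnonneg : ∀ i ∈ Finset.univ, 0 ≤ h.eigenvalues i * (Uᵀ *ᵥ v) i ^ 2 := by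
    intro i _
    by_cases hi : i = i₀
    · rw [hi, hi₀v]; simp
    · exact mul_nonneg (hother i hi).le (sq_nonneg _)
  rw [hQ]
  refine lt_of_le_of_ne (Finset.sum_nonneg hnonneg) fun h0 => hv ?_
  have hz := (Finset.sum_eq_zero_iff_of_nonneg hnonneg).mp h0.symm
  have hzero : Uᵀ *ᵥ v = 0 := by
    funext i
    by_cases hi : i = i₀
    · rw [hi, hi₀v]; rfl
    · have := hz i (Finset.mem_univ _)
      simpa [(hother i hi).ne'] using this
  calc v = (U * Uᵀ) *ᵥ v := by rw [hU, Matrix.one_mulVec]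
    _ = 0 := by rw [← Matrix.mulVec_mulVec, hzero, Matrix.mulVec_zero]

/-- A form that is positive on a hyperplane is positive on the orthogonal complement of every
negative vector. -/
theorem quadForm_pos_of_orthogonal (hM : M.IsSymm)
    (hu : ∃ u : Fin g → ℝ, ∀ v, v ≠ 0 → u ⬝ᵥ v = 0 → 0 < quadForm M v)
    {c x : Fin g → ℝ} (hc : quadForm M c < 0) (hx : x ≠ 0) (hcx : c ⬝ᵥ (M *ᵥ x) = 0) :
    0 < quadForm M x := by
  obtain ⟨u, hu⟩ := hu
  by_contra! hQ
  have hc0 : c ≠ 0 := by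
    rintro rfl
    simp [quadForm] at hc
  have huc : u ⬝ᵥ c ≠ 0 := fun h => lt_asymm hc (hu c hc0 h)
  -- The combination of `c` and `x` killed by `u`. As `c` and `x` are M-orthogonal with nonpositive
  -- values, the form is nonpositive at `v`, contradicting positivity on the hyperplane.
  set v := (u ⬝ᵥ x) • c + (-(u ⬝ᵥ c)) • x with hv
  have hQv : quadForm M v ≤ 0 := by
    rw [hv, quadForm_lin_comb hM, hcx]
    nlinarith [sq_nonneg (u ⬝ᵥ x), sq_nonneg (-(u ⬝ᵥ c)),
      mul_nonneg (sq_nonneg (u ⬝ᵥ x)) (neg_nonneg.mpr hc.le),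
      mul_nonneg (sq_nonneg (-(u ⬝ᵥ c))) (neg_nonneg.mpr hQ)]
  have hv0 : v ≠ 0 := by
    intro h0
    have h1 : c ⬝ᵥ (M *ᵥ v) = (u ⬝ᵥ x) * quadForm M c := by
      rw [hv]
      simp [Matrix.mulVec_add, Matrix.mulVec_smul, Matrix.mulVec_neg, hcx, quadForm]
    rw [h0, Matrix.mulVec_zero, dotProduct_zero] at h1
    have hux : u ⬝ᵥ x = 0 := by
      rcases mul_eq_zero.mp h1.symm with h | h
      · exact h
      · exact absurd h hc.ne
    rw [hv, hux, zero_smul, zero_add] at h0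
    rcases smul_eq_zero.mp h0 with h | h
    · exact huc (neg_eq_zero.mp h)
    · exact hx h
  refine absurd (hu v hv0 ?_) hQv.not_gt
  simp only [hv, dotProduct_add, dotProduct_smul, smul_eq_mul]
  ring

/-- The majorant `Q_M(x) - 2 (cᵀMx)² / Q_M(c)` is positive definite. -/
theorem majorant_pos (hM : M.IsSymm)
    (hu : ∃ u : Fin g → ℝ, ∀ v, v ≠ 0 → u ⬝ᵥ v = 0 → 0 < quadForm M v)
    {c x : Fin g → ℝ} (hc : quadForm M c < 0) (hx : x ≠ 0) :
    0 < (c ⬝ᵥ (M *ᵥ x)) ^ 2 / (-(1 / 2) * quadForm M c) + quadForm M x := by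
  set b := c ⬝ᵥ (M *ᵥ x) with hb
  set k := quadForm M c with hk
  have hbx : x ⬝ᵥ (M *ᵥ c) = b := dotProduct_mulVec_comm_of_isSymm hM x c
  -- The component of `x` that is M-orthogonal to `c`. Then Q_M(x) = Q_M(y) + b²/k, and the majorant
  -- becomes Q_M(y) - b²/k, a sum of two nonnegative terms.
  set y := (1 : ℝ) • x + (-(b / k)) • c with hy
  have hcy : c ⬝ᵥ (M *ᵥ y) = 0 := by
    have : c ⬝ᵥ (M *ᵥ c) = k := rfl
    simp only [hy, Matrix.mulVec_add, Matrix.mulVec_smul, dotProduct_add, dotProduct_smul,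
      smul_eq_mul, this, ← hb]
    field_simp [hc.ne]
    ring
  have hQy : quadForm M y = quadForm M x - b ^ 2 / k := by
    rw [hy, quadForm_lin_comb hM, hbx, ← hk]
    field_simp [hc.ne]
    ring
  have hsplit : b ^ 2 / (-(1 / 2) * k) + quadForm M x = quadForm M y + b ^ 2 / (-k) := by
    rw [hQy]
    field_simp [hc.ne]
    ring
  rw [hsplit]
  have hk' : 0 < -k := neg_pos.mpr hc
  by_cases hy0 : y = 0
  · have hb0 : b ≠ 0 := by
      intro h
      rw [hy, h] at hy0
      simp at hy0
      exact hx hy0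
    have h0 : quadForm M y = 0 := by simp [hy0, quadForm]
    rw [h0]
    positivity
  · have := quadForm_pos_of_orthogonal hM hu hc hy0 hcy
    positivity

/-- With bᵢ = cᵢᵀMx, the vector b₂c₁ - b₁c₂ is M-orthogonal to x. All three terms of its value
b₂²Q_M(c₁) - 2b₁b₂ c₁ᵀMc₂ + b₁²Q_M(c₂) are nonpositive, and the last is negative if b₁ ≠ 0. So x is
orthogonal to a negative vector. -/
theorem quadForm_pos_of_mul_nonpos (hM : M.IsSymm)
    (hu : ∃ u : Fin g → ℝ, ∀ v, v ≠ 0 → u ⬝ᵥ v = 0 → 0 < quadForm M v)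
    {c₁ c₂ x : Fin g → ℝ} (hc₁ : quadForm M c₁ < 0) (hc₂ : quadForm M c₂ < 0)
    (hc : c₁ ⬝ᵥ (M *ᵥ c₂) < 0) (hx : x ≠ 0)
    (hprod : (c₁ ⬝ᵥ (M *ᵥ x)) * (c₂ ⬝ᵥ (M *ᵥ x)) ≤ 0) :
    0 < quadForm M x := by
  by_cases h₁ : c₁ ⬝ᵥ (M *ᵥ x) = 0
  · exact quadForm_pos_of_orthogonal hM hu hc₁ hx h₁
  set b₁ := c₁ ⬝ᵥ (M *ᵥ x) with hb₁
  set b₂ := c₂ ⬝ᵥ (M *ᵥ x) with hb₂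
  refine quadForm_pos_of_orthogonal hM hu (c := b₂ • c₁ + (-b₁) • c₂) ?_ hx ?_
  · rw [quadForm_lin_comb hM]
    have h2 : 0 < b₁ ^ 2 := by positivity
    nlinarith [mul_neg_of_pos_of_neg h2 hc₂, mul_nonneg (sq_nonneg b₂) (neg_nonneg.mpr hc₁.le),
      mul_nonneg (neg_nonneg.mpr hprod) (neg_nonneg.mpr hc.le)]
  · simp only [add_dotProduct, smul_dotProduct, smul_eq_mul, ← hb₁, ← hb₂]
    ring

/-- A continuous function that is homogeneous of degree two and positive on a closed cone dominates
the square of the norm there. -/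
theorem exists_le_of_homogeneous {E : Type*} [NormedAddCommGroup E] [NormedSpace ℝ E]
    [ProperSpace E] {f : E → ℝ} (hf : Continuous f)
    (hhom : ∀ (a : ℝ) x, f (a • x) = a ^ 2 * f x) {K : Set E} (hK : IsClosed K)
    (hcone : ∀ (a : ℝ) x, x ∈ K → a • x ∈ K) (hpos : ∀ x ∈ K, x ≠ 0 → 0 < f x) :
    ∃ δ > 0, ∀ x ∈ K, δ * ‖x‖ ^ 2 ≤ f x := by
  have hcomp : IsCompact (Metric.sphere (0 : E) 1 ∩ K) := (isCompact_sphere _ _).inter_right hK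
  obtain ⟨δ, hδ, hle⟩ : ∃ δ > 0, ∀ x ∈ Metric.sphere (0 : E) 1 ∩ K, δ ≤ f x := by
    -- If the cone misses the unit sphere it contains at most the origin, and any δ works; otherwise
    -- δ is the minimum on a compact set.
    rcases (Metric.sphere (0 : E) 1 ∩ K).eq_empty_or_nonempty with he | hne
    · exact ⟨1, one_pos, by simp [he]⟩
    · obtain ⟨x₀, hx₀, hmin⟩ := hcomp.exists_isMinOn hne hf.continuousOn
      refine ⟨f x₀, hpos x₀ hx₀.2 ?_, fun x hx => hmin hx⟩
      rintro rfl
      simp at hx₀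
  refine ⟨δ, hδ, fun x hx => ?_⟩
  by_cases hx0 : x = 0
  · have : f 0 = 0 := by simpa using hhom 0 0
    simp [hx0, this]
  · have hn : 0 < ‖x‖ := norm_pos_iff.mpr hx0
    have hs : ‖x‖⁻¹ • x ∈ Metric.sphere (0 : E) 1 ∩ K :=
      ⟨by simp [norm_smul, hn.ne'], hcone _ _ hx⟩
    have := hle _ hs
    rw [hhom] at this
    calc δ * ‖x‖ ^ 2 ≤ (‖x‖⁻¹ ^ 2 * f x) * ‖x‖ ^ 2 := by gcongr
      _ = f x := by field_simp

end QuadraticForms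

/-- Inverse powers of the norm are summable over a shifted integer lattice. -/
theorem summable_norm_shift_rpow {g : ℕ} (q : Fin g → ℝ) {r : ℝ} (hr : r < -(g : ℝ)) :
    Summable fun m : Fin g → ℤ => ‖shift q m‖ ^ r := by
  let b := Pi.basisFun ℝ (Fin g)
  let B := b.restrictScalars ℤ
  have hrank : Module.finrank ℤ (Submodule.span ℤ (Set.range b)) = g := by
    rw [Module.finrank_eq_card_basis B, Fintype.card_fin]
  have h := ZLattice.summable_norm_sub_rpow (Submodule.span ℤ (Set.range b)) r
    (by rw [hrank]; exact hr) (-q)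
  refine (h.comp_injective B.equivFun.symm.injective).congr fun m => ?_
  have hm : ((B.equivFun.symm m : Submodule.span ℤ (Set.range b)) : Fin g → ℝ) - -q
      = shift q m := by
    funext i
    rw [Module.Basis.equivFun_symm_apply]
    simp [B, b, shift, Pi.single_apply]
  simp only [Function.comp_apply, hm]

/-! ### The Gamma integral with complex rate -/

section LaplaceTransform

theorem integrableOn_rpow_mul_exp_neg {σ r : ℝ} (hσ : 0 < σ) (hr : 0 < r) :
    IntegrableOn (fun t : ℝ => t ^ (σ - 1) * Real.exp (-(r * t))) (Ioi 0) := by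
  have h := integrableOn_rpow_mul_exp_neg_mul_rpow (s := σ - 1) (p := 1) (by linarith) one_pos hr
  refine h.congr_fun (fun t _ => ?_) measurableSet_Ioi
  simp

theorem norm_cpow_mul_exp_neg {t : ℝ} (ht : 0 < t) (a r : ℂ) :
    ‖(t : ℂ) ^ (a - 1) * cexp (-(r * t))‖ = t ^ (a.re - 1) * Real.exp (-(r.re * t)) := by
  rw [norm_mul, norm_cpow_eq_rpow_re_of_pos ht, Complex.norm_exp]
  simp

theorem continuousOn_ofReal_cpow_Ioi (a : ℂ) :
    ContinuousOn (fun t : ℝ => (t : ℂ) ^ a) (Ioi 0) := fun t ht =>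
  ((continuousAt_cpow_const (Or.inl (by simpa using ht))).comp
    continuous_ofReal.continuousAt).continuousWithinAt

theorem aestronglyMeasurable_cpow_mul_exp_neg (a r : ℂ) :
    AEStronglyMeasurable (fun t : ℝ => (t : ℂ) ^ (a - 1) * cexp (-(r * t)))
      (volume.restrict (Ioi 0)) :=
  ((continuousOn_ofReal_cpow_Ioi _).mul (by fun_prop)).aestronglyMeasurable measurableSet_Ioi

theorem integrableOn_cpow_mul_exp_neg {a r : ℂ} (ha : 0 < a.re) (hr : 0 < r.re) :
    IntegrableOn (fun t : ℝ => (t : ℂ) ^ (a - 1) * cexp (-(r * t))) (Ioi 0) := by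
  refine (integrableOn_rpow_mul_exp_neg ha hr).mono' (aestronglyMeasurable_cpow_mul_exp_neg a r) ?_
  filter_upwards [ae_restrict_mem measurableSet_Ioi] with t ht
  exact (norm_cpow_mul_exp_neg ht a r).le

theorem hasDerivAt_integral_cpow_mul_exp_neg {a r : ℂ} (ha : 0 < a.re) (hr : 0 < r.re) :
    HasDerivAt (fun r : ℂ => ∫ t : ℝ in Ioi 0, (t : ℂ) ^ (a - 1) * cexp (-(r * t)))
      (∫ t : ℝ in Ioi 0, (t : ℂ) ^ (a - 1) * (cexp (-(r * t)) * -t)) r := by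
  -- Near `r` the real part of the rate stays above Re(r)/2, so t^(Re a) exp(-Re(r) t/2) dominates
  -- the derivative in the rate.
  have hball : ∀ x ∈ Metric.ball r (r.re / 2), r.re / 2 < x.re := by
    intro x hx
    have h1 : |x.re - r.re| ≤ ‖x - r‖ := by simpa using abs_re_le_norm (x - r)
    have h2 : ‖x - r‖ < r.re / 2 := by simpa [dist_eq_norm] using hx
    have := (abs_lt.mp (h1.trans_lt h2)).1
    linarith
  refine (hasDerivAt_integral_of_dominated_loc_of_deriv_le
    (F' := fun (x : ℂ) (t : ℝ) => (t : ℂ) ^ (a - 1) * (cexp (-(x * t)) * -t))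
    (bound := fun t : ℝ => t ^ (a.re + 1 - 1) * Real.exp (-(r.re / 2 * t)))
    (Metric.ball_mem_nhds r (half_pos hr))
    (Eventually.of_forall fun x => aestronglyMeasurable_cpow_mul_exp_neg a x)
    (integrableOn_cpow_mul_exp_neg ha hr) ?_ ?_
    (integrableOn_rpow_mul_exp_neg (by linarith) (half_pos hr)) ?_).2
  · exact ((continuousOn_ofReal_cpow_Ioi _).mul (by fun_prop)).aestronglyMeasurable
      measurableSet_Ioi
  · filter_upwards [ae_restrict_mem measurableSet_Ioi] with t ht x hx
    have ht' : 0 < t := ht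
    rw [← mul_assoc, norm_mul, norm_cpow_mul_exp_neg ht, norm_neg, norm_real, Real.norm_eq_abs,
      abs_of_pos ht', add_sub_right_comm, Real.rpow_add_one ht'.ne', mul_right_comm]
    gcongr
    exact (hball x hx).le
  · refine Eventually.of_forall fun t x _ => ?_
    have h : HasDerivAt (fun x : ℂ => -(x * t)) (-(t : ℂ)) x := by
      simpa using ((hasDerivAt_id x).mul_const (t : ℂ)).fun_neg
    exact h.cexp.const_mul _

/-- The Gamma integral with a complex rate in the right half-plane. -/
theorem integral_cpow_mul_exp_neg {a r : ℂ} (ha : 0 < a.re) (hr : 0 < r.re) :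
    ∫ t : ℝ in Ioi 0, (t : ℂ) ^ (a - 1) * cexp (-(r * t)) = r ^ (-a) * Complex.Gamma a := by
  have hopen : IsOpen {z : ℂ | 0 < z.re} := isOpen_lt continuous_const continuous_re
  have hconn : IsPreconnected {z : ℂ | 0 < z.re} := (convex_halfSpace_re_gt 0).isPreconnected
  have hF : DifferentiableOn ℂ
      (fun r : ℂ => ∫ t : ℝ in Ioi 0, (t : ℂ) ^ (a - 1) * cexp (-(r * t))) {z | 0 < z.re} :=
    fun z hz => (hasDerivAt_integral_cpow_mul_exp_neg ha hz).differentiableAt.differentiableWithinAt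
  have hG : DifferentiableOn ℂ (fun r : ℂ => r ^ (-a) * Complex.Gamma a) {z | 0 < z.re} :=
    fun z hz => ((differentiableAt_id.cpow_const (Or.inl hz)).mul_const _).differentiableWithinAt
  -- Identity theorem: both sides are holomorphic in the right half-plane, and they agree at the
  -- real rates 1 + 1/(n+1), which accumulate at 1.
  refine (hF.analyticOnNhd hopen).eqOn_of_preconnected_of_frequently_eq (hG.analyticOnNhd hopen)
    hconn (z₀ := 1) (by simp) ?_ hr
  have hlim : Tendsto (fun n : ℕ => ((1 + 1 / ((n : ℝ) + 1) : ℝ) : ℂ)) atTop (𝓝[≠] 1) := by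
    refine tendsto_nhdsWithin_iff.mpr ⟨?_, Eventually.of_forall fun n => ?_⟩
    · have := (tendsto_one_div_add_atTop_nhds_zero_nat (𝕜 := ℝ)).const_add 1
      rw [add_zero] at this
      exact_mod_cast (continuous_ofReal.tendsto 1).comp this
    · have : (0 : ℝ) < 1 / ((n : ℝ) + 1) := by positivity
      simp only [mem_compl_iff, mem_singleton_iff]
      intro h
      have h' : (1 + 1 / ((n : ℝ) + 1) : ℝ) = 1 := by exact_mod_cast h
      linarith
  refine hlim.frequently (Frequently.of_forall fun n => ?_)
  have hx : (0 : ℝ) < 1 + 1 / ((n : ℝ) + 1) := by positivity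
  rw [integral_cpow_mul_exp_neg_mul_Ioi ha hx, one_div, inv_cpow, cpow_neg]
  rw [arg_ofReal_of_nonneg hx.le]
  exact Real.pi_pos.ne

end LaplaceTransform

/-! ### Integrating series and bounding Mellin transforms -/

section Series

/-- Tonelli for the norms. Points where the series diverges need no separate care, since the bound
of the norm of the sum by the sum of the norms holds in [0, ∞] everywhere. -/
theorem integrable_tsum_of_summable_integral_norm {α ι : Type*} [MeasurableSpace α] {μ : Measure α}
    [Countable ι] {F : ι → α → ℂ} (hF : ∀ i, Integrable (F i) μ)
    (hsum : Summable fun i => ∫ a, ‖F i a‖ ∂μ) : Integrable (fun a => ∑' i, F i a) μ := by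
  refine ⟨(AEMeasurable.tsum fun i => (hF i).aemeasurable).aestronglyMeasurable, ?_⟩
  have h : ∀ i, ∫⁻ a, ‖F i a‖ₑ ∂μ = ENNReal.ofReal (∫ a, ‖F i a‖ ∂μ) := fun i =>
    (ofReal_integral_norm_eq_lintegral_enorm (hF i)).symm
  calc ∫⁻ a, ‖∑' i, F i a‖ₑ ∂μ ≤ ∫⁻ a, ∑' i, ‖F i a‖ₑ ∂μ :=
        lintegral_mono fun a => enorm_tsum_le_tsum_enorm
    _ = ∑' i, ENNReal.ofReal (∫ a, ‖F i a‖ ∂μ) := by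
        rw [lintegral_tsum fun i => (hF i).aestronglyMeasurable.enorm]
        simp_rw [h]
    _ < ⊤ := hsum.tsum_ofReal_lt_top

/-- A function dominated by a decaying exponential has a Mellin transform bounded by a power of the
rate. -/
theorem mellinConvergent_of_norm_le_exp {f : ℝ → ℂ} {C r : ℝ} {s : ℂ} (hs : 0 < s.re) (hr : 0 < r)
    (hf : AEStronglyMeasurable f (volume.restrict (Ioi 0)))
    (hle : ∀ t, 0 < t → ‖f t‖ ≤ C * Real.exp (-(r * t))) :
    MellinConvergent f s ∧
      ∫ t in Ioi (0 : ℝ), ‖(t : ℂ) ^ (s - 1) • f t‖ ≤ C * Real.Gamma s.re * r ^ (-s.re) := by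
  have hint := (integrableOn_rpow_mul_exp_neg hs hr).const_mul C
  have hbound : ∀ᵐ t : ℝ ∂volume.restrict (Ioi 0), ‖(t : ℂ) ^ (s - 1) • f t‖ ≤
      C * (t ^ (s.re - 1) * Real.exp (-(r * t))) := by
    filter_upwards [ae_restrict_mem measurableSet_Ioi] with t ht
    have ht' : 0 < t := ht
    rw [norm_smul, norm_cpow_eq_rpow_re_of_pos ht, sub_re, one_re, mul_left_comm]
    gcongr
    exact hle t ht
  have hconv : MellinConvergent f s :=
    hint.mono' (((continuousOn_ofReal_cpow_Ioi _).aestronglyMeasurable measurableSet_Ioi).smul hf)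
      hbound
  refine ⟨hconv, (integral_mono_ae hconv.norm hint hbound).trans_eq ?_⟩
  rw [integral_const_mul, Real.integral_rpow_mul_exp_neg_mul_Ioi hs hr, one_div,
    Real.inv_rpow hr.le, Real.rpow_neg hr.le]
  ring

end Series

/-! ### Euler's integral for the principal branch of ₂F₁ -/

section Hypergeometric

theorem isOpen_cutPlane : IsOpen cutPlane :=
  Complex.isOpen_slitPlane.preimage (continuous_const.sub continuous_id)

/-- 1 - zu is the convex combination (1-u)·1 + u(1-z), and the slit plane is star-shaped about 1. -/
theorem mul_mem_cutPlane {z : ℂ} (hz : z ∈ cutPlane) {u : ℝ} (hu : u ∈ Icc (0 : ℝ) 1) :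
    z * u ∈ cutPlane := by
  have h := Complex.starConvex_one_slitPlane hz (sub_nonneg.mpr hu.2) hu.1 (by ring)
  have h2 : (1 - u) • (1 : ℂ) + u • (1 - z) = 1 - z * u := by
    simp only [real_smul, ofReal_sub, ofReal_one]
    ring
  rw [h2] at h
  exact h

theorem inv_sq_mem_Icc {v : ℝ} (hv : v ∈ Ioi (1 : ℝ)) : (v ^ 2)⁻¹ ∈ Icc (0 : ℝ) 1 :=
  ⟨by positivity, inv_le_one_of_one_le₀ (one_le_pow₀ (le_of_lt hv))⟩

theorem continuousOn_inv_sq : ContinuousOn (fun v : ℝ => (((v ^ 2)⁻¹ : ℝ) : ℂ)) (Ioi 1) := by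
  refine continuous_ofReal.comp_continuousOn ((continuous_pow 2).continuousOn.inv₀ fun v hv => ?_)
  have : (0 : ℝ) < v := one_pos.trans hv
  positivity

theorem continuousOn_cpow_Ioi_one (a : ℂ) : ContinuousOn (fun v : ℝ => (v : ℂ) ^ a) (Ioi 1) :=
  fun v hv => ((continuousAt_cpow_const (Or.inl (by simpa using one_pos.trans hv))).comp
    continuous_ofReal.continuousAt).continuousWithinAt

theorem continuousOn_comp_mul_inv_sq {h : ℂ → ℂ} (hh : ContinuousOn h cutPlane) {z : ℂ}
    (hz : z ∈ cutPlane) :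
    ContinuousOn (fun v : ℝ => h (z * ((v ^ 2)⁻¹ : ℝ))) (Ioi 1) :=
  hh.comp (continuousOn_const.mul continuousOn_inv_sq) fun _ hv =>
    mul_mem_cutPlane hz (inv_sq_mem_Icc hv)

/-- Averages over dilations of a function holomorphic on the cut plane are holomorphic there. -/
theorem differentiableOn_integral_dilation {h h' : ℂ → ℂ}
    (hh : ∀ w ∈ cutPlane, HasDerivAt h (h' w) w) (hh' : ContinuousOn h' cutPlane) {a : ℂ}
    (ha : a.re < -1) :
    DifferentiableOn ℂ (fun z : ℂ => ∫ v : ℝ in Ioi 1, (v : ℂ) ^ a * h (z * ((v ^ 2)⁻¹ : ℝ)))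
      cutPlane := by
  intro z₀ hz₀
  have hcont : ContinuousOn h cutPlane := fun w hw => (hh w hw).continuousAt.continuousWithinAt
  obtain ⟨ε, hε, hball⟩ := Metric.nhds_basis_closedBall.mem_iff.mp (isOpen_cutPlane.mem_nhds hz₀)
  -- A compact subset of the cut plane containing every argument z/v² for z near `z₀` and v > 1.
  -- Bounds for `h` and `h'` on it leave multiples of |v^a|, integrable since Re a < -1, as
  -- dominating functions.
  set K : Set ℂ := (fun x : ℂ × ℝ => x.1 * (x.2 : ℂ)) '' (Metric.closedBall z₀ ε ×ˢ Icc 0 1)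
  have hK : IsCompact K :=
    ((isCompact_closedBall z₀ ε).prod isCompact_Icc).image (by fun_prop)
  have hKsub : K ⊆ cutPlane := by
    rintro _ ⟨⟨z, u⟩, ⟨hz, hu⟩, rfl⟩
    exact mul_mem_cutPlane (hball hz) hu
  obtain ⟨C, hC⟩ := hK.exists_bound_of_continuousOn (hcont.mono hKsub)
  obtain ⟨C', hC'⟩ := hK.exists_bound_of_continuousOn (hh'.mono hKsub)
  have hmemK : ∀ z ∈ Metric.closedBall z₀ ε, ∀ v ∈ Ioi (1 : ℝ), z * ((v ^ 2)⁻¹ : ℝ) ∈ K :=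
    fun z hz v hv => ⟨(z, (v ^ 2)⁻¹), ⟨hz, inv_sq_mem_Icc hv⟩, rfl⟩
  have hpow : IntegrableOn (fun v : ℝ => (v : ℂ) ^ a) (Ioi 1) :=
    integrableOn_Ioi_cpow_of_lt ha one_pos
  have hmeas : ∀ z ∈ cutPlane, AEStronglyMeasurable
      (fun v : ℝ => (v : ℂ) ^ a * h (z * ((v ^ 2)⁻¹ : ℝ))) (volume.restrict (Ioi 1)) := fun z hz =>
    ((continuousOn_cpow_Ioi_one a).mul
      (continuousOn_comp_mul_inv_sq hcont hz)).aestronglyMeasurable measurableSet_Ioi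
  refine (hasDerivAt_integral_of_dominated_loc_of_deriv_le
    (F' := fun (z : ℂ) (v : ℝ) =>
      (v : ℂ) ^ a * (h' (z * ((v ^ 2)⁻¹ : ℝ)) * ((v ^ 2)⁻¹ : ℝ)))
    (bound := fun v : ℝ => ‖(v : ℂ) ^ a‖ * C')
    (Metric.closedBall_mem_nhds z₀ hε) ?_ ?_ ?_ ?_ (hpow.norm.mul_const C')
    ?_).2.differentiableAt.differentiableWithinAt
  · filter_upwards [isOpen_cutPlane.mem_nhds hz₀] with z hz using hmeas z hz
  · refine (hpow.norm.mul_const C).mono' (hmeas z₀ hz₀) ?_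
    filter_upwards [ae_restrict_mem measurableSet_Ioi] with v hv
    rw [norm_mul]
    gcongr
    exact hC _ (hmemK z₀ (Metric.mem_closedBall_self hε.le) v hv)
  · exact ((continuousOn_cpow_Ioi_one a).mul ((continuousOn_comp_mul_inv_sq hh' hz₀).mul
      continuousOn_inv_sq)).aestronglyMeasurable measurableSet_Ioi
  · filter_upwards [ae_restrict_mem measurableSet_Ioi] with v hv z hz
    have hu := inv_sq_mem_Icc hv
    have h1 : ‖(((v ^ 2)⁻¹ : ℝ) : ℂ)‖ ≤ 1 := by
      rw [norm_real, Real.norm_eq_abs, abs_of_nonneg hu.1]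
      exact hu.2
    have h2 := hC' _ (hmemK z hz v hv)
    rw [norm_mul, norm_mul]
    gcongr
    calc _ ≤ C' * 1 := mul_le_mul h2 h1 (norm_nonneg _) ((norm_nonneg _).trans h2)
      _ = C' := mul_one _
  · filter_upwards [ae_restrict_mem measurableSet_Ioi] with v hv z hz
    have h1 : HasDerivAt (fun z : ℂ => z * (((v ^ 2)⁻¹ : ℝ) : ℂ)) (((v ^ 2)⁻¹ : ℝ) : ℂ) z := by
      have := (hasDerivAt_id z).mul_const (((v ^ 2)⁻¹ : ℝ) : ℂ)
      rwa [one_mul] at this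
    exact ((hh _ (hKsub (hmemK z hz v hv))).comp z h1).const_mul _

/-- The binomial series, with the coefficient C(b+n-1, n) rewritten as (b)_n / n! to match the
hypergeometric series. -/
theorem hasSum_one_sub_cpow_neg (b : ℂ) {x : ℂ} (hx : ‖x‖ < 1) :
    HasSum (fun n : ℕ => ((n.factorial : ℂ)⁻¹ * (ascPochhammer ℂ n).eval b) * x ^ n)
      ((1 - x) ^ (-b)) := by
  have hmem : x ∈ Metric.eball (0 : ℂ) 1 := by
    simpa [← ofReal_norm, ENNReal.ofReal_lt_one] using hx
  have h := (one_div_one_sub_cpow_hasFPowerSeriesOnBall_zero b).hasSum hmem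
  rw [zero_add, one_div, ← cpow_neg] at h
  refine h.congr_fun fun n => ?_
  have h1 : Ring.choose (b + n - 1) n = (n.factorial : ℂ)⁻¹ * (ascPochhammer ℂ n).eval b := by
    have h2 := Ring.factorial_nsmul_multichoose_eq_ascPochhammer b n
    have h3 : Ring.choose (b + n - 1) n = Ring.multichoose b n := by
      rw [Ring.choose]
      congr 1
      ring
    rw [Polynomial.ascPochhammer_smeval_eq_eval, nsmul_eq_mul] at h2
    rw [h3, ← h2, inv_mul_cancel_left₀ (by exact_mod_cast n.factorial_ne_zero)]
  simp [h1, mul_comm]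

/-- The quotient (s)_n / (s+1)_n telescopes; the condition Re s > 0 keeps all factors nonzero. -/
theorem ascPochhammer_eval_mul_inv_succ {s : ℂ} (hs : 0 < s.re) (n : ℕ) :
    (ascPochhammer ℂ n).eval s * ((ascPochhammer ℂ n).eval (s + 1))⁻¹ = s / (s + n) := by
  have hne : ∀ k : ℕ, s + k ≠ 0 := fun k h => by
    have := congrArg re h
    simp at this
    have : (0 : ℝ) ≤ k := k.cast_nonneg
    linarith
  induction n with
  | zero => simp [div_self (by simpa using hne 0 : s ≠ 0)]
  | succ n ih =>
    rw [ascPochhammer_succ_eval, ascPochhammer_succ_eval, mul_inv, mul_mul_mul_comm, ih]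
    have h1 := hne n
    have h2 : s + 1 + n ≠ 0 := by
      have := hne (n + 1)
      push_cast at this
      rwa [add_assoc, add_comm 1 (n : ℂ)]
    push_cast
    rw [← add_assoc, add_right_comm s (n : ℂ) 1]
    field_simp

theorem integral_Ioi_one_cpow_mul_pow {s : ℂ} (hs : 0 < s.re) (n : ℕ) :
    ∫ v : ℝ in Ioi 1, (v : ℂ) ^ (-2 * s - 1) * (((v ^ 2)⁻¹ : ℝ) : ℂ) ^ n = 1 / (2 * (s + n)) := by
  have hcongr : ∀ v ∈ Ioi (1 : ℝ), (v : ℂ) ^ (-2 * s - 1) * (((v ^ 2)⁻¹ : ℝ) : ℂ) ^ n =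
      (v : ℂ) ^ (-2 * s - 1 - 2 * n) := by
    intro v hv
    have hv0 : (v : ℂ) ≠ 0 := by
      have : (0 : ℝ) < v := one_pos.trans hv
      exact_mod_cast this.ne'
    rw [cpow_sub _ (2 * (n : ℂ)) hv0, div_eq_mul_inv]
    congr 1
    push_cast
    rw [inv_pow, ← pow_mul, ← cpow_natCast]
    push_cast
    rfl
  have hn : (0 : ℝ) ≤ n := n.cast_nonneg
  rw [setIntegral_congr_fun measurableSet_Ioi hcongr, integral_Ioi_cpow_of_lt _ one_pos]
  · rw [ofReal_one, one_cpow,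
      show -2 * s - 1 - 2 * (n : ℂ) + 1 = -(2 * (s + n)) by ring, neg_div_neg_eq]
  · simp
    linarith

/-- Euler's integral for `₂F₁(s, b; s + 1; z)`, in the variable `v = w^{-1/2}`. -/
noncomputable def eulerIntegral (s b z : ℂ) : ℂ :=
  2 * s * ∫ v : ℝ in Ioi 1, (v : ℂ) ^ (-2 * s - 1) * (1 - z * ((v ^ 2)⁻¹ : ℝ)) ^ (-b)

/-- Expand (1 - z/v²)^(-b) by the binomial series, valid as |z/v²| < 1, and integrate termwise: 2s
∫_1^∞ v^(-2s-1-2n) dv = s/(s+n) = (s)_n / (s+1)_n. -/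
theorem eulerIntegral_eq_ordinaryHypergeometric {s : ℂ} (hs : 0 < s.re) (b : ℂ) {z : ℂ}
    (hz : ‖z‖ < 1) : eulerIntegral s b z = ordinaryHypergeometric s b (s + 1) z := by
  set A : ℕ → ℂ := fun n => (n.factorial : ℂ)⁻¹ * (ascPochhammer ℂ n).eval b with hA
  have ha : (-2 * s - 1).re < -1 := by simp; linarith
  have hpow : IntegrableOn (fun v : ℝ => (v : ℂ) ^ (-2 * s - 1)) (Ioi 1) :=
    integrableOn_Ioi_cpow_of_lt ha one_pos
  set F : ℕ → ℝ → ℂ := fun n v =>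
    (A n * z ^ n) * ((v : ℂ) ^ (-2 * s - 1) * (((v ^ 2)⁻¹ : ℝ) : ℂ) ^ n) with hF
  have hnorm : ∀ v ∈ Ioi (1 : ℝ), ‖(((v ^ 2)⁻¹ : ℝ) : ℂ)‖ ≤ 1 := fun v hv => by
    rw [norm_real, Real.norm_eq_abs, abs_of_nonneg (inv_sq_mem_Icc hv).1]
    exact (inv_sq_mem_Icc hv).2
  have hbound : ∀ n, ∀ᵐ v ∂volume.restrict (Ioi (1 : ℝ)),
      ‖F n v‖ ≤ ‖A n * z ^ n‖ * ‖(v : ℂ) ^ (-2 * s - 1)‖ := fun n => by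
    filter_upwards [ae_restrict_mem measurableSet_Ioi] with v hv
    rw [hF]
    simp only
    rw [norm_mul, norm_mul ((v : ℂ) ^ _), norm_pow]
    gcongr
    exact mul_le_of_le_one_right (norm_nonneg _) (pow_le_one₀ (norm_nonneg _) (hnorm v hv))
  have hint : ∀ n, Integrable (F n) (volume.restrict (Ioi 1)) := fun n => by
    refine (hpow.norm.const_mul ‖A n * z ^ n‖).mono' ?_ (hbound n)
    exact (continuousOn_const.mul ((continuousOn_cpow_Ioi_one _).mul
      (continuousOn_inv_sq.pow n))).aestronglyMeasurable measurableSet_Ioi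
  have hAz : Summable fun n => ‖A n * z ^ n‖ := (hasSum_one_sub_cpow_neg b hz).summable.norm
  have hsum : Summable fun n => ∫ v : ℝ in Ioi 1, ‖F n v‖ := by
    refine Summable.of_nonneg_of_le (fun n => integral_nonneg fun v => norm_nonneg _) (fun n => ?_)
      (hAz.mul_right (∫ v : ℝ in Ioi 1, ‖(v : ℂ) ^ (-2 * s - 1)‖))
    rw [← integral_const_mul]
    exact integral_mono_ae (hint n).norm (hpow.norm.const_mul _) (hbound n)
  have key := hasSum_integral_of_summable_integral_norm hint hsum
  have hpt : ∫ v : ℝ in Ioi 1, ∑' n, F n v =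
      ∫ v : ℝ in Ioi 1, (v : ℂ) ^ (-2 * s - 1) * (1 - z * ((v ^ 2)⁻¹ : ℝ)) ^ (-b) := by
    refine setIntegral_congr_fun measurableSet_Ioi fun v hv => ?_
    have hlt : ‖z * (((v ^ 2)⁻¹ : ℝ) : ℂ)‖ < 1 := by
      rw [norm_mul]
      exact (mul_le_of_le_one_right (norm_nonneg _) (hnorm v hv)).trans_lt hz
    refine (((hasSum_one_sub_cpow_neg b hlt).mul_left ((v : ℂ) ^ (-2 * s - 1))).congr_fun
      fun n => ?_).tsum_eq
    simp only [hF, hA, mul_pow]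
    ring
  rw [hpt] at key
  rw [eulerIntegral, ordinaryHypergeometric_eq_tsum]
  refine ((key.mul_left (2 * s)).congr_fun fun n => ?_).tsum_eq.symm
  have hne : s + n ≠ 0 := fun h => by
    have := congrArg re h
    simp at this
    have : (0 : ℝ) ≤ n := n.cast_nonneg
    linarith
  simp only [hF, integral_const_mul, integral_Ioi_one_cpow_mul_pow hs, smul_eq_mul]
  calc _ = (A n * z ^ n) *
        ((ascPochhammer ℂ n).eval s * ((ascPochhammer ℂ n).eval (s + 1))⁻¹) := by
        simp only [hA]
        ring
    _ = _ := by
        rw [ascPochhammer_eval_mul_inv_succ hs]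
        field_simp

/-- This supplies the existence of the branch that `hypergeometric` chooses; uniqueness of the
continuation then gives its values on the whole cut plane. -/
theorem isHypergeometricBranch_eulerIntegral {s : ℂ} (hs : 0 < s.re) (b : ℂ) :
    IsHypergeometricBranch s b (s + 1) (eulerIntegral s b) := by
  refine ⟨DifferentiableOn.const_mul (differentiableOn_integral_dilation
    (h := fun w => (1 - w) ^ (-b)) (h' := fun w => b * (1 - w) ^ (-b - 1)) (fun w hw => ?_) ?_ ?_) _,
    fun z hz => eulerIntegral_eq_ordinaryHypergeometric hs b hz⟩
  · have h1 : HasDerivAt (fun w : ℂ => 1 - w) (-1) w := by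
      simpa using (hasDerivAt_id w).const_sub 1
    convert h1.cpow_const (c := -b) hw using 1
    ring
  · exact continuousOn_const.mul
      ((continuousOn_const.sub continuousOn_id).cpow_const fun w hw => hw)
  · simp
    linarith

theorem hypergeometric_eq_eulerIntegral {s : ℂ} (hs : 0 < s.re) (b : ℂ) {z : ℂ}
    (hz : z ∈ cutPlane) : hypergeometric s b (s + 1) z = eulerIntegral s b z :=
  (isHypergeometricBranch_eulerIntegral hs b).hypergeometric_eq hz

end Hypergeometric

/-! ### The Gaussian tail -/

section GaussTail

/-- The complementary incomplete Gaussian integral `∫_x^∞ exp(-π u²) du`. -/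
noncomputable def gaussTail (x : ℝ) : ℝ := ∫ u in Ioi x, Real.exp (-Real.pi * u ^ 2)

theorem integrable_exp_neg_pi_mul_sq : Integrable fun u : ℝ => Real.exp (-Real.pi * u ^ 2) :=
  integrable_exp_neg_mul_sq Real.pi_pos

theorem gaussTail_zero : gaussTail 0 = 1 / 2 := by
  rw [gaussTail, integral_gaussian_Ioi, div_self Real.pi_pos.ne', Real.sqrt_one]

theorem gaussTail_nonneg (x : ℝ) : 0 ≤ gaussTail x := integral_nonneg fun _ => (Real.exp_pos _).le

theorem gaussTail_add_incompleteGauss (x : ℝ) : gaussTail x + incompleteGauss x = 1 / 2 := by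
  rw [← gaussTail_zero, incompleteGauss, gaussTail, gaussTail, add_comm]
  exact intervalIntegral.integral_interval_add_Ioi integrable_exp_neg_pi_mul_sq.integrableOn
    integrable_exp_neg_pi_mul_sq.integrableOn

theorem continuous_gaussTail : Continuous gaussTail := by
  have h : gaussTail = fun x => 1 / 2 - incompleteGauss x := by
    funext x
    rw [← gaussTail_add_incompleteGauss x, add_sub_cancel_right]
  rw [h]
  exact continuous_const.sub (intervalIntegral.continuous_primitive
    (fun _ _ => integrable_exp_neg_pi_mul_sq.intervalIntegrable) 0)

theorem incompleteGauss_neg (x : ℝ) : incompleteGauss (-x) = -incompleteGauss x := by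
  have h := intervalIntegral.integral_comp_neg (a := 0) (b := x)
    (fun u : ℝ => Real.exp (-Real.pi * u ^ 2))
  simp only [neg_sq, neg_zero] at h
  rw [incompleteGauss, incompleteGauss, h, intervalIntegral.integral_symm]

/-- The source of the decomposition: the sign half leads to the zeta series, the tail half to the ξ
series. -/
theorem incompleteGauss_eq_sign_sub (x : ℝ) :
    incompleteGauss x = Real.sign x / 2 - Real.sign x * gaussTail |x| := by
  rcases lt_trichotomy x 0 with h | rfl | h
  · have h1 := gaussTail_add_incompleteGauss (-x)
    rw [incompleteGauss_neg] at h1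
    rw [Real.sign_of_neg h, abs_of_neg h]
    linarith
  · simp [incompleteGauss]
  · have h1 := gaussTail_add_incompleteGauss x
    rw [Real.sign_of_pos h, abs_of_pos h]
    linarith

/-- Translate to the half-line u > 0 and use (u + x)² ≥ u² + x²; the factor 1/2 is the full
half-line integral. -/
theorem gaussTail_le {x : ℝ} (hx : 0 ≤ x) :
    gaussTail x ≤ 1 / 2 * Real.exp (-Real.pi * x ^ 2) := by
  have hshift : gaussTail x = ∫ u in Ioi (0 : ℝ), Real.exp (-Real.pi * (u + x) ^ 2) := by
    have h := (measurePreserving_add_right volume x).setIntegral_preimage_emb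
      (measurableEmbedding_addRight x) (fun u => Real.exp (-Real.pi * u ^ 2)) (Ioi x)
    rw [gaussTail, ← h]
    simp
  rw [hshift, ← gaussTail_zero, gaussTail, ← integral_mul_const]
  refine setIntegral_mono_on ?_ (integrable_exp_neg_pi_mul_sq.integrableOn.mul_const _)
    measurableSet_Ioi fun u hu => ?_
  · exact (integrable_exp_neg_pi_mul_sq.comp_add_right x).integrableOn
  · rw [← Real.exp_add]
    refine Real.exp_le_exp.mpr ?_
    have hu' : 0 < u := hu
    nlinarith [Real.pi_pos, mul_nonneg Real.pi_pos.le (mul_nonneg hu'.le hx)]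

/-- The scaling moves `b` from the limit into the integrand, so that with b = √t α the domain of
integration does not depend on t. -/
theorem gaussTail_eq_integral_Ioi_one {b : ℝ} (hb : 0 < b) :
    gaussTail b = ∫ v in Ioi (1 : ℝ), b * Real.exp (-Real.pi * (b * v) ^ 2) := by
  rw [integral_const_mul, integral_comp_mul_left_Ioi (fun u => Real.exp (-Real.pi * u ^ 2)) 1 hb,
    mul_one, smul_eq_mul, mul_inv_cancel_left₀ hb.ne', gaussTail]

end GaussTail

/-! ### The Mellin transform of a Gaussian tail times an exponential -/

section TailTransform

/-- A positive factor does not change the argument, so the principal power is multiplicative here.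
-/
theorem ofReal_mul_cpow {r : ℝ} (hr : 0 < r) {y : ℂ} (hy : y ≠ 0) (w : ℂ) :
    ((r : ℂ) * y) ^ w = (r : ℂ) ^ w * y ^ w := by
  have hr' : (r : ℂ) ≠ 0 := by exact_mod_cast hr.ne'
  rw [cpow_def_of_ne_zero (mul_ne_zero hr' hy), cpow_def_of_ne_zero hr', cpow_def_of_ne_zero hy,
    log_ofReal_mul hr hy, ofReal_log hr.le, add_mul, exp_add]

/-- The Gaussian tail times an exponential. -/
noncomputable def tailExp (α : ℝ) (Q : ℂ) (t : ℝ) : ℂ :=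
  (gaussTail (Real.sqrt t * α) : ℂ) * cexp (-(Real.pi * Q * t))

theorem continuous_tailExp (α : ℝ) (Q : ℂ) : Continuous (tailExp α Q) :=
  (continuous_ofReal.comp (continuous_gaussTail.comp (by fun_prop))).mul (by fun_prop)

theorem norm_exp_neg_pi_mul (Q : ℂ) (t : ℝ) :
    ‖cexp (-(Real.pi * Q * t))‖ = Real.exp (-(Real.pi * Q.re * t)) := by
  rw [Complex.norm_exp]
  congr 1
  simp [mul_assoc]

/-- The tail contributes exp(-πα²t), which allows Re Q to be negative as long as α² + Re Q is
positive. -/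
theorem norm_tailExp_le {α : ℝ} (hα : 0 ≤ α) (Q : ℂ) {t : ℝ} (ht : 0 ≤ t) :
    ‖tailExp α Q t‖ ≤ 1 / 2 * Real.exp (-(Real.pi * (α ^ 2 + Q.re) * t)) := by
  rw [tailExp, norm_mul, norm_exp_neg_pi_mul, norm_real, Real.norm_eq_abs,
    abs_of_nonneg (gaussTail_nonneg _)]
  calc _ ≤ (1 / 2 * Real.exp (-Real.pi * (Real.sqrt t * α) ^ 2)) *
        Real.exp (-(Real.pi * Q.re * t)) := by
        gcongr
        exact gaussTail_le (by positivity)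
    _ = _ := by
        rw [mul_assoc, ← Real.exp_add, mul_pow, Real.sq_sqrt ht]
        ring_nf

theorem mellinConvergent_tailExp {α : ℝ} (hα : 0 < α) {Q s : ℂ} (hQ : 0 < α ^ 2 + Q.re)
    (hs : 0 < s.re) : MellinConvergent (tailExp α Q) s :=
  (mellinConvergent_of_norm_le_exp hs (mul_pos Real.pi_pos hQ)
    (continuous_tailExp α Q).aestronglyMeasurable fun _ ht => norm_tailExp_le hα.le Q ht.le).1

/-- The integrand of the double integral for the Mellin transform of `tailExp`. -/
noncomputable def tailKernel (α : ℝ) (Q s : ℂ) (t v : ℝ) : ℂ :=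
  ((t : ℂ) ^ (s - 1) * cexp (-(Real.pi * Q * t))) *
    ((Real.sqrt t * α * Real.exp (-Real.pi * (Real.sqrt t * α * v) ^ 2) : ℝ) : ℂ)

theorem integral_tailKernel_right {α : ℝ} (hα : 0 < α) (Q s : ℂ) {t : ℝ} (ht : 0 < t) :
    ∫ v in Ioi (1 : ℝ), tailKernel α Q s t v = (t : ℂ) ^ (s - 1) • tailExp α Q t := by
  have h := gaussTail_eq_integral_Ioi_one (mul_pos (Real.sqrt_pos.mpr ht) hα)
  simp only [tailKernel]
  rw [integral_const_mul, integral_complex_ofReal, ← h, tailExp, smul_eq_mul]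
  ring

theorem integral_norm_tailKernel_right {α : ℝ} (hα : 0 < α) (Q s : ℂ) {t : ℝ} (ht : 0 < t) :
    ∫ v in Ioi (1 : ℝ), ‖tailKernel α Q s t v‖ = ‖(t : ℂ) ^ (s - 1) • tailExp α Q t‖ := by
  have hb := mul_pos (Real.sqrt_pos.mpr ht) hα
  have h := gaussTail_eq_integral_Ioi_one hb
  have hn : ∀ v : ℝ, ‖((Real.sqrt t * α * Real.exp (-Real.pi * (Real.sqrt t * α * v) ^ 2) : ℝ) : ℂ)‖
      = Real.sqrt t * α * Real.exp (-Real.pi * (Real.sqrt t * α * v) ^ 2) := fun v => by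
    rw [norm_real, Real.norm_eq_abs, abs_of_pos (by positivity)]
  simp only [tailKernel, norm_mul _ ((_ : ℝ) : ℂ), hn]
  rw [integral_const_mul, ← h, tailExp, smul_eq_mul, norm_mul, norm_mul, norm_mul, norm_real,
    Real.norm_eq_abs, abs_of_nonneg (gaussTail_nonneg _)]
  ring

/-- The Gaussian factor is nonnegative, so integrating the modulus over v gives exactly the modulus
of the Mellin integrand of `tailExp`; integrability on the product reduces to convergence of that
transform. -/
theorem integrable_tailKernel {α : ℝ} (hα : 0 < α) {Q s : ℂ} (hQ : 0 < α ^ 2 + Q.re)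
    (hs : 0 < s.re) :
    Integrable (Function.uncurry (tailKernel α Q s))
      ((volume.restrict (Ioi 0)).prod (volume.restrict (Ioi 1))) := by
  have hmeas : AEStronglyMeasurable (Function.uncurry (tailKernel α Q s))
      ((volume.restrict (Ioi 0)).prod (volume.restrict (Ioi 1))) := by
    rw [Measure.prod_restrict]
    refine ContinuousOn.aestronglyMeasurable ?_ (measurableSet_Ioi.prod measurableSet_Ioi)
    refine ContinuousOn.mul (ContinuousOn.mul ?_ (by fun_prop)) (by fun_prop)
    exact (continuousOn_ofReal_cpow_Ioi _).comp continuousOn_fst fun x hx => hx.1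
  rw [integrable_prod_iff hmeas]
  constructor
  · filter_upwards [ae_restrict_mem measurableSet_Ioi] with t ht
    have hb := mul_pos (Real.sqrt_pos.mpr ht) hα
    have h := (integrable_exp_neg_pi_mul_sq.comp_mul_left' hb.ne').const_mul (Real.sqrt t * α)
    exact ((h.ofReal (𝕜 := ℂ)).const_mul
      ((t : ℂ) ^ (s - 1) * cexp (-(Real.pi * Q * t)))).integrableOn
  · refine (mellinConvergent_tailExp hα hQ hs).norm.congr ?_
    filter_upwards [ae_restrict_mem measurableSet_Ioi] with t ht
    exact (integral_norm_tailKernel_right hα Q s ht).symm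

/-- The factor √t shifts s to s + 1/2, and the Gaussian merges with the exponential into the rate
π(α²v² + Q) = π(αv)²(1 + Q/(αv)²), to which the Gamma integral applies. -/
theorem integral_tailKernel_left {α : ℝ} (hα : 0 < α) {Q s : ℂ} (hQ : 0 < α ^ 2 + Q.re)
    (hs : 0 < s.re) {v : ℝ} (hv : 1 < v) :
    ∫ t in Ioi (0 : ℝ), tailKernel α Q s t v =
      (Real.pi : ℂ) ^ (-(s + 1 / 2)) * Complex.Gamma (s + 1 / 2) * ((α ^ 2 : ℝ) : ℂ) ^ (-s) *
        ((v : ℂ) ^ (-2 * s - 1) *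
          (1 - -Q / (α : ℂ) ^ 2 * (((v ^ 2)⁻¹ : ℝ) : ℂ)) ^ (-(s + 1 / 2))) := by
  have hv0 : 0 < v := one_pos.trans hv
  have hα' : (α : ℂ) ≠ 0 := by exact_mod_cast hα.ne'
  have hv' : (v : ℂ) ≠ 0 := by exact_mod_cast hv0.ne'
  set r : ℂ := Real.pi * ((α : ℂ) ^ 2 * (v : ℂ) ^ 2 + Q) with hr
  have hre : 0 < α ^ 2 * v ^ 2 + Q.re := by
    have : 1 ≤ v ^ 2 := one_le_pow₀ (n := 2) hv.le
    nlinarith [mul_nonneg (sq_nonneg α) (sub_nonneg.mpr this)]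
  have hrre : 0 < r.re := by
    have : r = ((Real.pi * (α ^ 2 * v ^ 2) : ℝ) : ℂ) + (Real.pi : ℝ) * Q := by
      rw [hr]; push_cast; ring
    rw [this, add_re, ofReal_re, re_ofReal_mul, ← mul_add]
    exact mul_pos Real.pi_pos hre
  have hcongr : ∀ t ∈ Ioi (0 : ℝ), tailKernel α Q s t v =
      α * ((t : ℂ) ^ (s + 1 / 2 - 1) * cexp (-(r * t))) := by
    intro t ht
    have ht' : 0 < t := ht
    have h1 : (t : ℂ) ^ (s + 1 / 2 - 1) = (t : ℂ) ^ (s - 1) * (Real.sqrt t : ℂ) := by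
      rw [Real.sqrt_eq_rpow, ofReal_cpow ht'.le, add_sub_right_comm,
        cpow_add _ _ (by exact_mod_cast ht'.ne')]
      norm_num
    have h2 : cexp (-(r * t)) = cexp (-(Real.pi * Q * t)) *
        ((Real.exp (-Real.pi * (Real.sqrt t * α * v) ^ 2) : ℝ) : ℂ) := by
      rw [mul_pow, mul_pow, Real.sq_sqrt ht'.le, ofReal_exp, ← exp_add, hr]
      congr 1
      push_cast
      ring
    rw [h1, h2, tailKernel]
    push_cast
    ring
  rw [setIntegral_congr_fun measurableSet_Ioi hcongr, integral_const_mul,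
    integral_cpow_mul_exp_neg (by simp; linarith) hrre]
  set y : ℂ := 1 - -Q / (α : ℂ) ^ 2 * (((v ^ 2)⁻¹ : ℝ) : ℂ) with hy
  have hry : r = (Real.pi : ℝ) * (((α * v) ^ 2 : ℝ) * y) := by
    rw [hr, hy]
    push_cast
    field_simp
    ring
  have hr0 : r ≠ 0 := fun h => by simp [h] at hrre
  have hy0 : y ≠ 0 := fun h => hr0 (by rw [hry, h]; simp)
  have hαv : 0 < α * v := mul_pos hα hv0
  have hsq : ((((α * v) ^ 2 : ℝ) : ℂ)) ≠ 0 := by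
    have : (α * v) ^ 2 ≠ 0 := by positivity
    exact_mod_cast this
  -- The stray α from the substitution turns α^(-2s-1) into α^(-2s).
  have hpow : (((α * v) ^ 2 : ℝ) : ℂ) ^ (-(s + 1 / 2)) * α =
      ((α ^ 2 : ℝ) : ℂ) ^ (-s) * (v : ℂ) ^ (-2 * s - 1) := by
    have hsq_cpow : ∀ x : ℝ, 0 < x → ∀ w : ℂ, ((x ^ 2 : ℝ) : ℂ) ^ w = (x : ℂ) ^ (2 * w) := by
      intro x hx w
      rw [pow_two, ofReal_mul, mul_cpow_ofReal_nonneg hx.le hx.le,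
        ← cpow_add _ _ (by exact_mod_cast hx.ne'), two_mul]
    rw [hsq_cpow _ hαv, hsq_cpow _ hα, ofReal_mul, mul_cpow_ofReal_nonneg hα.le hv0.le,
      show 2 * -(s + 1 / 2) = -2 * s - 1 by ring, mul_right_comm]
    congr 1
    nth_rewrite 2 [← cpow_one (α : ℂ)]
    rw [← cpow_add _ _ hα']
    congr 1
    ring
  rw [hry, ofReal_mul_cpow Real.pi_pos (mul_ne_zero hsq hy0),
    ofReal_mul_cpow (by positivity) hy0]
  linear_combination (Real.pi : ℂ) ^ (-(s + 1 / 2)) * Complex.Gamma (s + 1 / 2) *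
    y ^ (-(s + 1 / 2)) * hpow

/-- The Mellin transform of `tailExp` is a hypergeometric function. -/
theorem mellin_tailExp {α : ℝ} (hα : 0 < α) {Q s : ℂ} (hQ : 0 < α ^ 2 + Q.re) (hs : 0 < s.re) :
    mellin (tailExp α Q) s =
      (Real.pi : ℂ) ^ (-(s + 1 / 2)) * Complex.Gamma (s + 1 / 2) *
        (1 / (2 * s) * (((α ^ 2 : ℝ) : ℂ) ^ (-s) *
          hypergeometric s (s + 1 / 2) (s + 1) (-Q / (α : ℂ) ^ 2))) := by
  -- The argument avoids [1, ∞) because 1 + Q/α² = (α² + Q)/α² has positive real part.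
  have hz : -Q / (α : ℂ) ^ 2 ∈ cutPlane := by
    refine Or.inl ?_
    have h1 : 1 - -Q / (α : ℂ) ^ 2 = (((α ^ 2)⁻¹ : ℝ) : ℂ) * (((α ^ 2 : ℝ) : ℂ) + Q) := by
      have hα' : (α : ℂ) ≠ 0 := by exact_mod_cast hα.ne'
      push_cast
      field_simp
      ring
    rw [h1, re_ofReal_mul, add_re, ofReal_re]
    positivity
  have hs0 : s ≠ 0 := fun h => by simp [h] at hs
  have hswap := integral_integral_swap (integrable_tailKernel hα hQ hs)
  rw [setIntegral_congr_fun measurableSet_Ioi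
      fun t ht => integral_tailKernel_right hα Q s ht,
    setIntegral_congr_fun measurableSet_Ioi
      fun v hv => integral_tailKernel_left hα hQ hs hv, integral_const_mul] at hswap
  rw [mellin, hswap, hypergeometric_eq_eulerIntegral hs _ hz, eulerIntegral]
  field_simp

end TailTransform

variable {g : ℕ}

/-! ### Mellin transforms of lattice series -/

section LatticeSeries

/-- Termwise Mellin transformation of a series over a shifted lattice whose terms decay like
Gaussians in the lattice point. -/
theorem hasSum_mellin_of_norm_le_exp (q : Fin g → ℝ) {s : ℂ} (hs : (g : ℝ) / 2 < s.re)
    {f : (Fin g → ℤ) → ℝ → ℂ} {C κ : ℝ} (hC : 0 ≤ C) (hκ : 0 < κ) (hcont : ∀ m, Continuous (f m))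
    (hzero : ∀ m, shift q m = 0 → ∀ t, f m t = 0)
    (hle : ∀ m, ∀ t, 0 < t → ‖f m t‖ ≤ C * Real.exp (-(κ * ‖shift q m‖ ^ 2 * t))) :
    MellinConvergent (fun t => ∑' m, f m t) s ∧
      HasSum (fun m => mellin (f m) s) (mellin (fun t => ∑' m, f m t) s) := by
  have hg : (0 : ℝ) ≤ g := g.cast_nonneg
  have hs0 : 0 < s.re := by linarith
  have hterm : ∀ m, MellinConvergent (f m) s ∧ ∫ t in Ioi (0 : ℝ), ‖(t : ℂ) ^ (s - 1) • f m t‖ ≤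
      C * Real.Gamma s.re * κ ^ (-s.re) * ‖shift q m‖ ^ (-(2 * s.re)) := by
    intro m
    -- At the origin of the shifted lattice the exponential bound gives no decay, which is why the
    -- term is required to vanish there.
    by_cases hm : shift q m = 0
    · have h0 : f m = fun _ => 0 := funext (hzero m hm)
      have hΓ := Real.Gamma_pos_of_pos hs0
      refine ⟨by simp [h0, MellinConvergent], ?_⟩
      simp only [h0, smul_zero, norm_zero, integral_zero]
      positivity
    · have hN : 0 < ‖shift q m‖ := norm_pos_iff.mpr hm
      obtain ⟨h1, h2⟩ := mellinConvergent_of_norm_le_exp hs0 (mul_pos hκ (pow_pos hN 2))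
        (hcont m).aestronglyMeasurable (hle m)
      refine ⟨h1, h2.trans_eq ?_⟩
      rw [Real.mul_rpow hκ.le (by positivity), ← Real.rpow_natCast, ← Real.rpow_mul hN.le]
      push_cast
      rw [mul_neg]
      ring
  have hint : ∀ m, Integrable (fun t : ℝ => (t : ℂ) ^ (s - 1) • f m t)
      (volume.restrict (Ioi 0)) := fun m => (hterm m).1
  -- The exponent -2 Re s lies below -g exactly because Re s > g/2.
  have hsum : Summable fun m => ∫ t in Ioi (0 : ℝ), ‖(t : ℂ) ^ (s - 1) • f m t‖ :=
    Summable.of_nonneg_of_le (fun m => integral_nonneg fun t => norm_nonneg _)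
      (fun m => (hterm m).2) ((summable_norm_shift_rpow q (by linarith)).mul_left _)
  have h1 := integrable_tsum_of_summable_integral_norm hint hsum
  have h2 := hasSum_integral_of_summable_integral_norm hint hsum
  simp only [smul_eq_mul, tsum_mul_left] at h1 h2
  exact ⟨h1, h2⟩

end LatticeSeries

/-! ### Uniform lower bounds for the forms -/

section Forms

theorem re_twistedForm (Ω : Matrix (Fin g) (Fin g) ℂ) (n : Fin g → ℝ) :
    (twistedForm Ω n).re = quadForm (imPart Ω) n := by
  simp [twistedForm, quadForm, dotProduct, Matrix.mulVec, imPart, Complex.re_sum, Complex.im_sum]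

theorem pairing_zero_right (Ω : Matrix (Fin g) (Fin g) ℂ) (c : Fin g → ℝ) :
    pairing Ω c 0 = 0 := by
  simp [pairing]

theorem isSymm_imPart {Ω : Matrix (Fin g) (Fin g) ℂ} (hΩ : Ω.IsSymm) : (imPart Ω).IsSymm := by
  rw [Matrix.IsSymm, imPart, ← Matrix.transpose_map, hΩ.eq]

/-- The square of the pairing with a cone parameter, normalized, completes `Q_M` to a positive
definite form; together with positivity of `Q_M` between the cone parameters this gives uniform
quadratic lower bounds. -/
theorem exists_quadratic_lower_bound {Ω : Matrix (Fin g) (Fin g) ℂ}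
    (hΩ : Ω ∈ siegelIntermediate g 1) {c₁ c₂ : Fin g → ℝ} (hc₁ : quadForm (imPart Ω) c₁ < 0)
    (hc₂ : quadForm (imPart Ω) c₂ < 0) (hc : pairing Ω c₁ c₂ < 0) :
    ∃ δ > 0, (∀ x, pairing Ω c₁ x * pairing Ω c₂ x ≤ 0 → δ * ‖x‖ ^ 2 ≤ quadForm (imPart Ω) x) ∧
      ∀ c ∈ ({c₁, c₂} : Set (Fin g → ℝ)), ∀ x, δ * ‖x‖ ^ 2 ≤
        pairing Ω c x ^ 2 / (-(1 / 2) * quadForm (imPart Ω) c) + quadForm (imPart Ω) x := by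
  obtain ⟨hsymm, h, hpos, hneg⟩ := hΩ
  have hM := isSymm_imPart hsymm
  have hu := exists_functional_of_signature h hpos hneg
  have hlin : ∀ (c : Fin g → ℝ) (a : ℝ) x, pairing Ω c (a • x) = a * pairing Ω c x := by
    intro c a x
    simp [pairing, Matrix.mulVec_smul]
  have hcont : ∀ c : Fin g → ℝ, Continuous (pairing Ω c) := fun c =>
    continuous_const.dotProduct (continuous_const.matrix_mulVec continuous_id)
  -- The condition on the product of the pairings is closed and, being quadratic, stable under all
  -- real scalings.
  obtain ⟨δ₀, hδ₀, h₀⟩ := exists_le_of_homogeneous (continuous_quadForm (imPart Ω))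
    (fun a x => quadForm_smul a x) (K := {x | pairing Ω c₁ x * pairing Ω c₂ x ≤ 0})
    (isClosed_le ((hcont c₁).mul (hcont c₂)) continuous_const)
    (fun a x hx => by
      simp only [mem_ofPred_eq, hlin] at hx ⊢
      nlinarith [mul_nonneg (sq_nonneg a) (neg_nonneg.mpr hx)])
    (fun x hx hx0 => quadForm_pos_of_mul_nonpos hM hu hc₁ hc₂ hc hx0 hx)
  have hmaj : ∀ c : Fin g → ℝ, quadForm (imPart Ω) c < 0 → ∃ δ > 0, ∀ x, δ * ‖x‖ ^ 2 ≤
      pairing Ω c x ^ 2 / (-(1 / 2) * quadForm (imPart Ω) c) + quadForm (imPart Ω) x := by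
    intro c hcneg
    obtain ⟨δ, hδ, h⟩ := exists_le_of_homogeneous
      (f := fun x => pairing Ω c x ^ 2 / (-(1 / 2) * quadForm (imPart Ω) c) + quadForm (imPart Ω) x)
      ((((hcont c).pow 2).div_const _).add (continuous_quadForm (imPart Ω)))
      (fun a x => by
        simp only [hlin, quadForm_smul]
        ring)
      isClosed_univ (fun _ _ _ => mem_univ _) (fun x _ hx0 => majorant_pos hM hu hcneg hx0)
    exact ⟨δ, hδ, fun x => h x (mem_univ x)⟩
  obtain ⟨δ₁, hδ₁, h₁⟩ := hmaj c₁ hc₁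
  obtain ⟨δ₂, hδ₂, h₂⟩ := hmaj c₂ hc₂
  refine ⟨min δ₀ (min δ₁ δ₂), by positivity, fun x hx => le_trans ?_ (h₀ x hx), ?_⟩
  · gcongr
    exact min_le_left _ _
  · rintro c (rfl | rfl) x
    · refine le_trans ?_ (h₁ x)
      gcongr
      exact (min_le_right _ _).trans (min_le_left _ _)
    · refine le_trans ?_ (h₂ x)
      gcongr
      exact (min_le_right _ _).trans (min_le_right _ _)

theorem mul_nonpos_of_sign_ne {a b : ℝ} (h : Real.sign a ≠ Real.sign b) : a * b ≤ 0 := by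
  by_contra! hab
  rcases pos_and_pos_or_neg_and_neg_of_mul_pos hab with ⟨ha, hb⟩ | ⟨ha, hb⟩
  · exact h (by rw [Real.sign_of_pos ha, Real.sign_of_pos hb])
  · exact h (by rw [Real.sign_of_neg ha, Real.sign_of_neg hb])

theorem abs_sign_le_one (x : ℝ) : |Real.sign x| ≤ 1 := by
  rcases Real.sign_apply_eq x with h | h | h <;> simp [h]

theorem norm_e_ofReal (x : ℝ) : ‖e (x : ℂ)‖ = 1 := by
  rw [e, show 2 * (Real.pi : ℂ) * I * x = ((2 * Real.pi * x : ℝ) : ℂ) * I by push_cast; ring,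
    norm_exp_ofReal_mul_I]

end Forms

/-! ### The theta function along the ray tΩ -/

section ThetaRay

/-- The normalized pairing `cᵀ M n / √(-½ Q_M(c))`. -/
noncomputable def normalizedPairing (Ω : Matrix (Fin g) (Fin g) ℂ) (c n : Fin g → ℝ) : ℝ :=
  pairing Ω c n / Real.sqrt (-(1 / 2) * quadForm (imPart Ω) c)

theorem imPart_smul (Ω : Matrix (Fin g) (Fin g) ℂ) (t : ℝ) :
    imPart ((t : ℂ) • Ω) = t • imPart Ω := by
  ext i j
  simp [imPart]

/-- The real vector p drops out of the imaginary part; the numerator scales by t and the denominator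
by √t. -/
theorem thetaArg_ray (c p q : Fin g → ℝ) (Ω : Matrix (Fin g) (Fin g) ℂ) {t : ℝ} (ht : 0 < t)
    (m : Fin g → ℤ) :
    thetaArg c ((fun i => (p i : ℂ)) + ((t : ℂ) • Ω) *ᵥ (fun i => (q i : ℂ))) ((t : ℂ) • Ω) m =
      Real.sqrt t * normalizedPairing Ω c (shift q m) := by
  have hnum : (fun i => ((((t : ℂ) • Ω) *ᵥ (fun j => (m j : ℂ)) +
      ((fun i => (p i : ℂ)) + ((t : ℂ) • Ω) *ᵥ (fun i => (q i : ℂ)))) i).im) =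
      t • (imPart Ω *ᵥ shift q m) := by
    funext i
    simp only [Pi.add_apply, Pi.smul_apply, Matrix.mulVec, dotProduct, add_im, im_sum, ofReal_im,
      zero_add, Matrix.smul_apply, smul_eq_mul, Finset.mul_sum, shift, imPart, Matrix.map_apply]
    rw [← Finset.sum_add_distrib]
    refine Finset.sum_congr rfl fun j _ => ?_
    simp
    ring
  have hden : -(1 / 2) * quadForm (imPart ((t : ℂ) • Ω)) c =
      t * (-(1 / 2) * quadForm (imPart Ω) c) := by
    rw [imPart_smul, quadForm, Matrix.smul_mulVec, dotProduct_smul, smul_eq_mul, quadForm]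
    ring
  rw [thetaArg, hnum, hden, Real.sqrt_mul ht.le, dotProduct_smul, smul_eq_mul, normalizedPairing,
    pairing]
  nth_rewrite 1 [← Real.mul_self_sqrt ht.le]
  have := (Real.sqrt_pos.mpr ht).ne'
  rw [mul_assoc, mul_div_mul_left _ _ this, mul_div_assoc]

theorem quadForm_shift {Ω : Matrix (Fin g) (Fin g) ℂ} (hΩ : Ω.IsSymm) (q : Fin g → ℝ)
    (m : Fin g → ℤ) :
    quadForm Ω (fun i => (shift q m i : ℂ)) = quadForm Ω (fun i => (m i : ℂ)) +
      2 * ((fun i => (m i : ℂ)) ⬝ᵥ (Ω *ᵥ fun i => (q i : ℂ))) +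
        quadForm Ω (fun i => (q i : ℂ)) := by
  have h : (fun i => (shift q m i : ℂ)) = (fun i => (m i : ℂ)) + fun i => (q i : ℂ) := by
    funext i
    simp [shift]
  have hcomm : (fun i => (q i : ℂ)) ⬝ᵥ (Ω *ᵥ fun i => (m i : ℂ)) =
      (fun i => (m i : ℂ)) ⬝ᵥ (Ω *ᵥ fun i => (q i : ℂ)) := by
    rw [Matrix.dotProduct_mulVec, ← Matrix.mulVec_transpose, hΩ.eq, dotProduct_comm]
  rw [h, quadForm, Matrix.mulVec_add, dotProduct_add, add_dotProduct, add_dotProduct, hcomm,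
    quadForm, quadForm]
  ring

/-- Completing the square: the characteristic prefactor turns the quadratic and linear terms in m
into the form at m + q. The symmetry of Ω joins the two cross terms. -/
theorem e_ray {Ω : Matrix (Fin g) (Fin g) ℂ} (hΩ : Ω.IsSymm) (p q : Fin g → ℝ) (t : ℝ)
    (m : Fin g → ℤ) :
    e (1 / 2 * quadForm ((t : ℂ) • Ω) (fun i => (q i : ℂ)) + ((p ⬝ᵥ q : ℝ) : ℂ)) *
      e (1 / 2 * quadForm ((t : ℂ) • Ω) (fun i => (m i : ℂ)) + (fun i => (m i : ℂ)) ⬝ᵥ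
        ((fun i => (p i : ℂ)) + ((t : ℂ) • Ω) *ᵥ (fun i => (q i : ℂ)))) =
      e ((p ⬝ᵥ shift q m : ℝ) : ℂ) * cexp (-(Real.pi * twistedForm Ω (shift q m) * t)) := by
  have hp : ((p ⬝ᵥ shift q m : ℝ) : ℂ) =
      (fun i => (m i : ℂ)) ⬝ᵥ (fun i => (p i : ℂ)) + ((p ⬝ᵥ q : ℝ) : ℂ) := by
    simp only [dotProduct, shift, ofReal_sum, ← Finset.sum_add_distrib]
    refine Finset.sum_congr rfl fun i _ => ?_
    push_cast
    ring
  have hsmul : ∀ (a : ℂ) (v : Fin g → ℂ), quadForm (a • Ω) v = a * quadForm Ω v := by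
    intro a v
    rw [quadForm, Matrix.smul_mulVec, dotProduct_smul, smul_eq_mul, quadForm]
  simp only [e, ← exp_add]
  congr 1
  rw [twistedForm, hsmul, hsmul, hsmul, quadForm_shift hΩ, hp, dotProduct_add, Matrix.smul_mulVec,
    dotProduct_smul, smul_eq_mul]
  ring

theorem thetaRay_eq_tsum {Ω : Matrix (Fin g) (Fin g) ℂ} (hΩ : Ω.IsSymm) (c₁ c₂ p q : Fin g → ℝ)
    {t : ℝ} (ht : 0 < t) :
    thetaRay c₁ c₂ p q Ω t = ∑' m : Fin g → ℤ,
      ((incompleteGauss (Real.sqrt t * normalizedPairing Ω c₂ (shift q m)) -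
        incompleteGauss (Real.sqrt t * normalizedPairing Ω c₁ (shift q m)) : ℝ) : ℂ) *
      (e ((p ⬝ᵥ shift q m : ℝ) : ℂ) * cexp (-(Real.pi * twistedForm Ω (shift q m) * t))) := by
  rw [thetaRay, thetaNull, theta, ← tsum_mul_left]
  refine tsum_congr fun m => ?_
  rw [thetaArg_ray c₁ p q Ω ht, thetaArg_ray c₂ p q Ω ht, mul_left_comm, e_ray hΩ]

/-- The contribution of a lattice point to the incomplete zeta function, before the Mellin
transform. -/
noncomputable def zetaRayTerm (c₁ c₂ p q : Fin g → ℝ) (Ω : Matrix (Fin g) (Fin g) ℂ)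
    (m : Fin g → ℤ) (t : ℝ) : ℂ :=
  (1 / 2 * ((Real.sign (pairing Ω c₂ (shift q m)) -
    Real.sign (pairing Ω c₁ (shift q m)) : ℝ) : ℂ) * e ((p ⬝ᵥ shift q m : ℝ) : ℂ)) *
      cexp (-(Real.pi * twistedForm Ω (shift q m) * t))

/-- The contribution of a lattice point to the correction series, before the Mellin transform. -/
noncomputable def xiRayTerm (c p q : Fin g → ℝ) (Ω : Matrix (Fin g) (Fin g) ℂ)
    (m : Fin g → ℤ) (t : ℝ) : ℂ :=
  ((Real.sign (pairing Ω c (shift q m)) : ℂ) * e ((p ⬝ᵥ shift q m : ℝ) : ℂ)) *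
    tailExp |normalizedPairing Ω c (shift q m)| (twistedForm Ω (shift q m)) t

theorem incompleteGauss_sqrt_mul_normalizedPairing {Ω : Matrix (Fin g) (Fin g) ℂ} {c : Fin g → ℝ}
    (hc : quadForm (imPart Ω) c < 0) (n : Fin g → ℝ) {t : ℝ} (ht : 0 < t) :
    incompleteGauss (Real.sqrt t * normalizedPairing Ω c n) =
      Real.sign (pairing Ω c n) / 2 -
        Real.sign (pairing Ω c n) * gaussTail (Real.sqrt t * |normalizedPairing Ω c n|) := by
  have hk : 0 < Real.sqrt (-(1 / 2) * quadForm (imPart Ω) c) := Real.sqrt_pos.mpr (by linarith)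
  have ht' := Real.sqrt_pos.mpr ht
  have hsign : Real.sign (Real.sqrt t * normalizedPairing Ω c n) = Real.sign (pairing Ω c n) := by
    rw [normalizedPairing]
    rcases lt_trichotomy (pairing Ω c n) 0 with h | h | h
    · rw [Real.sign_of_neg h,
        Real.sign_of_neg (mul_neg_of_pos_of_neg ht' (div_neg_of_neg_of_pos h hk))]
    · simp [h]
    · rw [Real.sign_of_pos h, Real.sign_of_pos (mul_pos ht' (div_pos h hk))]
  rw [incompleteGauss_eq_sign_sub, hsign, abs_mul, abs_of_pos ht']

theorem thetaRay_eq_tsum_rayTerms {Ω : Matrix (Fin g) (Fin g) ℂ} (hΩ : Ω.IsSymm)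
    {c₁ c₂ : Fin g → ℝ} (hc₁ : quadForm (imPart Ω) c₁ < 0) (hc₂ : quadForm (imPart Ω) c₂ < 0)
    (p q : Fin g → ℝ) {t : ℝ} (ht : 0 < t) :
    thetaRay c₁ c₂ p q Ω t = ∑' m : Fin g → ℤ,
      (zetaRayTerm c₁ c₂ p q Ω m t - (xiRayTerm c₂ p q Ω m t - xiRayTerm c₁ p q Ω m t)) := by
  rw [thetaRay_eq_tsum hΩ c₁ c₂ p q ht]
  refine tsum_congr fun m => ?_
  rw [incompleteGauss_sqrt_mul_normalizedPairing hc₁ _ ht,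
    incompleteGauss_sqrt_mul_normalizedPairing hc₂ _ ht, zetaRayTerm, xiRayTerm, xiRayTerm,
    tailExp, tailExp]
  push_cast
  ring

theorem continuous_zetaRayTerm (c₁ c₂ p q : Fin g → ℝ) (Ω : Matrix (Fin g) (Fin g) ℂ)
    (m : Fin g → ℤ) : Continuous (zetaRayTerm c₁ c₂ p q Ω m) := by
  unfold zetaRayTerm
  fun_prop

theorem continuous_xiRayTerm (c p q : Fin g → ℝ) (Ω : Matrix (Fin g) (Fin g) ℂ)
    (m : Fin g → ℤ) : Continuous (xiRayTerm c p q Ω m) :=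
  continuous_const.mul (continuous_tailExp _ _)

theorem zetaRayTerm_of_shift_eq_zero (c₁ c₂ p : Fin g → ℝ) {q : Fin g → ℝ}
    (Ω : Matrix (Fin g) (Fin g) ℂ) {m : Fin g → ℤ} (hm : shift q m = 0) (t : ℝ) :
    zetaRayTerm c₁ c₂ p q Ω m t = 0 := by
  simp [zetaRayTerm, hm, pairing_zero_right]

theorem xiRayTerm_of_shift_eq_zero (c p : Fin g → ℝ) {q : Fin g → ℝ}
    (Ω : Matrix (Fin g) (Fin g) ℂ) {m : Fin g → ℤ} (hm : shift q m = 0) (t : ℝ) :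
    xiRayTerm c p q Ω m t = 0 := by
  simp [xiRayTerm, hm, pairing_zero_right]

theorem sq_normalizedPairing {Ω : Matrix (Fin g) (Fin g) ℂ} {c : Fin g → ℝ}
    (hc : quadForm (imPart Ω) c < 0) (n : Fin g → ℝ) :
    |normalizedPairing Ω c n| ^ 2 = pairing Ω c n ^ 2 / (-(1 / 2) * quadForm (imPart Ω) c) := by
  rw [sq_abs, normalizedPairing, div_pow, Real.sq_sqrt (by linarith)]

theorem norm_zetaRayTerm_le {Ω : Matrix (Fin g) (Fin g) ℂ} {c₁ c₂ p q : Fin g → ℝ} {m : Fin g → ℤ}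
    {δ : ℝ} (hδ : pairing Ω c₁ (shift q m) * pairing Ω c₂ (shift q m) ≤ 0 →
      δ * ‖shift q m‖ ^ 2 ≤ quadForm (imPart Ω) (shift q m)) {t : ℝ} (ht : 0 < t) :
    ‖zetaRayTerm c₁ c₂ p q Ω m t‖ ≤ Real.exp (-(Real.pi * δ * ‖shift q m‖ ^ 2 * t)) := by
  by_cases hsign : Real.sign (pairing Ω c₁ (shift q m)) = Real.sign (pairing Ω c₂ (shift q m))
  · simp [zetaRayTerm, hsign, (Real.exp_pos _).le]
  · have h := hδ (mul_nonpos_of_sign_ne hsign)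
    rw [zetaRayTerm, norm_mul, norm_mul, norm_e_ofReal, mul_one, norm_exp_neg_pi_mul,
      re_twistedForm, norm_mul, norm_real, Real.norm_eq_abs]
    have h1 : |Real.sign (pairing Ω c₂ (shift q m)) - Real.sign (pairing Ω c₁ (shift q m))| ≤ 2 :=
      (abs_sub _ _).trans (by
        linarith [abs_sign_le_one (pairing Ω c₂ (shift q m)),
          abs_sign_le_one (pairing Ω c₁ (shift q m))])
    have h2 : ‖(1 / 2 : ℂ)‖ = 1 / 2 := by norm_num
    rw [h2]
    refine (mul_le_of_le_one_left (Real.exp_pos _).le (by linarith)).trans ?_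
    rw [mul_assoc Real.pi δ]
    gcongr

theorem norm_xiRayTerm_le {Ω : Matrix (Fin g) (Fin g) ℂ} {c p q : Fin g → ℝ} {m : Fin g → ℤ}
    (hc : quadForm (imPart Ω) c < 0) {δ : ℝ} (hδ : δ * ‖shift q m‖ ^ 2 ≤
      pairing Ω c (shift q m) ^ 2 / (-(1 / 2) * quadForm (imPart Ω) c) +
        quadForm (imPart Ω) (shift q m)) {t : ℝ} (ht : 0 < t) :
    ‖xiRayTerm c p q Ω m t‖ ≤ Real.exp (-(Real.pi * δ * ‖shift q m‖ ^ 2 * t)) := by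
  rw [xiRayTerm, norm_mul, norm_mul, norm_e_ofReal, mul_one, norm_real, Real.norm_eq_abs]
  refine (mul_le_of_le_one_left (norm_nonneg _) (abs_sign_le_one _)).trans ?_
  refine (norm_tailExp_le (abs_nonneg _) _ ht.le).trans ?_
  rw [sq_normalizedPairing hc, re_twistedForm, mul_assoc Real.pi δ]
  refine (mul_le_of_le_one_left (Real.exp_pos _).le (by norm_num)).trans ?_
  gcongr

/-- If the signs differ, the Gamma integral applies; if they agree, both sides vanish whatever the
sign of Re Q_{-iΩ}(n). -/
theorem hasMellin_zetaRayTerm {Ω : Matrix (Fin g) (Fin g) ℂ} {c₁ c₂ p q : Fin g → ℝ}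
    {m : Fin g → ℤ} (hpos : Real.sign (pairing Ω c₁ (shift q m)) ≠
      Real.sign (pairing Ω c₂ (shift q m)) → 0 < (twistedForm Ω (shift q m)).re)
    {s : ℂ} (hs : 0 < s.re) :
    HasMellin (zetaRayTerm c₁ c₂ p q Ω m) s
      ((Real.pi : ℂ) ^ (-s) * Complex.Gamma s * (1 / 2 * zetaTerm c₁ c₂ p q Ω s m)) := by
  by_cases hsign : Real.sign (pairing Ω c₁ (shift q m)) = Real.sign (pairing Ω c₂ (shift q m))
  · have h0 : zetaRayTerm c₁ c₂ p q Ω m = fun _ => 0 := by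
      funext t
      simp [zetaRayTerm, hsign]
    simp [HasMellin, h0, zetaTerm, hsign, MellinConvergent, mellin]
  · have hQ := hpos hsign
    have hr : 0 < ((Real.pi : ℂ) * twistedForm Ω (shift q m)).re := by
      rw [re_ofReal_mul]
      exact mul_pos Real.pi_pos hQ
    have hQ0 : twistedForm Ω (shift q m) ≠ 0 := fun h => by simp [h] at hQ
    have h := integral_cpow_mul_exp_neg hs hr
    rw [ofReal_mul_cpow Real.pi_pos hQ0] at h
    have hconv : MellinConvergent
        (fun t : ℝ => cexp (-(Real.pi * twistedForm Ω (shift q m) * t))) s :=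
      integrableOn_cpow_mul_exp_neg hs hr
    have key := hasMellin_const_smul hconv (1 / 2 * ((Real.sign (pairing Ω c₂ (shift q m)) -
      Real.sign (pairing Ω c₁ (shift q m)) : ℝ) : ℂ) * e ((p ⬝ᵥ shift q m : ℝ) : ℂ))
    refine ⟨key.1, key.2.trans ?_⟩
    rw [mellin]
    simp only [smul_eq_mul]
    rw [h, zetaTerm]
    ring

theorem hasMellin_xiRayTerm {Ω : Matrix (Fin g) (Fin g) ℂ} {c p q : Fin g → ℝ} {m : Fin g → ℤ}
    (hc : quadForm (imPart Ω) c < 0)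
    (hpos : shift q m ≠ 0 → 0 < pairing Ω c (shift q m) ^ 2 / (-(1 / 2) * quadForm (imPart Ω) c) +
      quadForm (imPart Ω) (shift q m)) {s : ℂ} (hs : 0 < s.re) :
    HasMellin (xiRayTerm c p q Ω m) s
      ((Real.pi : ℂ) ^ (-(s + 1 / 2)) * Complex.Gamma (s + 1 / 2) *
        (1 / (2 * s) * xiTerm c p q Ω s m)) := by
  by_cases hb : pairing Ω c (shift q m) = 0
  · have h0 : xiRayTerm c p q Ω m = fun _ => 0 := by
      funext t
      simp [xiRayTerm, hb]
    simp [HasMellin, h0, xiTerm, hb, MellinConvergent, mellin]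
  · have hn0 : shift q m ≠ 0 := fun h => hb (by rw [h, pairing_zero_right])
    have hsq := sq_normalizedPairing hc (shift q m)
    have hα : 0 < |normalizedPairing Ω c (shift q m)| :=
      abs_pos.mpr (div_ne_zero hb (Real.sqrt_pos.mpr (by linarith)).ne')
    have hQ : 0 < |normalizedPairing Ω c (shift q m)| ^ 2 + (twistedForm Ω (shift q m)).re := by
      rw [hsq, re_twistedForm]
      exact hpos hn0
    have key := hasMellin_const_smul (mellinConvergent_tailExp hα hQ hs)
      ((Real.sign (pairing Ω c (shift q m)) : ℂ) * e ((p ⬝ᵥ shift q m : ℝ) : ℂ))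
    refine ⟨key.1, key.2.trans ?_⟩
    -- With α² = (cᵀMn)² / (-½ Q_M(c)), the quotient -Q/α² is the stated hypergeometric argument.
    have harg : -twistedForm Ω (shift q m) / ((|normalizedPairing Ω c (shift q m)| : ℝ) : ℂ) ^ 2 =
        ((quadForm (imPart Ω) c : ℝ) : ℂ) * twistedForm Ω (shift q m) /
          (2 * (pairing Ω c (shift q m) : ℂ) ^ 2) := by
      have hb' : (pairing Ω c (shift q m) : ℂ) ≠ 0 := by exact_mod_cast hb
      have hc' : ((quadForm (imPart Ω) c : ℝ) : ℂ) ≠ 0 := by exact_mod_cast hc.ne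
      rw [← ofReal_pow, hsq]
      push_cast
      field_simp
    rw [mellin_tailExp hα hQ hs, harg, hsq, xiTerm, smul_eq_mul]
    ring

end ThetaRay

end IndefiniteZeta

/-! ### Assembly of the identity -/

theorem theorem1p2 (g : ℕ) (Ω : Matrix (Fin g) (Fin g) ℂ) (hΩ : Ω ∈ siegelIntermediate g 1)
    (c₁ c₂ p q : Fin g → ℝ)
    (hc₁ : quadForm (imPart Ω) c₁ < 0) (hc₂ : quadForm (imPart Ω) c₂ < 0)
    (hc : pairing Ω c₁ c₂ < 0)
    (s : ℂ) (hs : (g : ℝ) / 2 < s.re) :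
    (∀ m : Fin g → ℤ,
      Real.sign (pairing Ω c₁ (shift q m)) ≠ Real.sign (pairing Ω c₂ (shift q m)) →
        0 < (twistedForm Ω (shift q m)).re) ∧
    MellinConvergent (thetaRay c₁ c₂ p q Ω) s ∧
    Summable (zetaTerm c₁ c₂ p q Ω s) ∧
    Summable (xiTerm c₁ p q Ω s) ∧
    Summable (xiTerm c₂ p q Ω s) ∧
    completedZeta c₁ c₂ p q Ω s =
      (Real.pi : ℂ) ^ (-s) * Complex.Gamma s * incompleteZeta c₁ c₂ p q Ω s -
        (Real.pi : ℂ) ^ (-(s + 1 / 2)) * Complex.Gamma (s + 1 / 2) *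
          (xi c₂ p q Ω s - xi c₁ p q Ω s) := by
  obtain ⟨δ, hδ, hcone, hmaj⟩ := exists_quadratic_lower_bound hΩ hc₁ hc₂ hc
  have hmaj₁ := hmaj c₁ (by simp)
  have hmaj₂ := hmaj c₂ (by simp)
  have hs0 : 0 < s.re := lt_of_le_of_lt (by positivity) hs
  have hnorm : ∀ m, shift q m ≠ 0 → 0 < δ * ‖shift q m‖ ^ 2 := fun m hm =>
    mul_pos hδ (pow_pos (norm_pos_iff.mpr hm) 2)
  have hpos : ∀ m : Fin g → ℤ,
      Real.sign (pairing Ω c₁ (shift q m)) ≠ Real.sign (pairing Ω c₂ (shift q m)) →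
        0 < (twistedForm Ω (shift q m)).re := by
    intro m hm
    have hm0 : shift q m ≠ 0 := fun h => hm (by rw [h, pairing_zero_right, pairing_zero_right])
    rw [re_twistedForm]
    exact (hnorm m hm0).trans_le (hcone _ (mul_nonpos_of_sign_ne hm))
  have hκ : 0 < Real.pi * δ := mul_pos Real.pi_pos hδ
  have hZle := fun m t (ht : 0 < t) =>
    norm_zetaRayTerm_le (p := p) (q := q) (m := m) (hcone (shift q m)) ht
  have hX₁le := fun m t (ht : 0 < t) =>
    norm_xiRayTerm_le (p := p) (q := q) (m := m) hc₁ (hmaj₁ (shift q m)) ht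
  have hX₂le := fun m t (ht : 0 < t) =>
    norm_xiRayTerm_le (p := p) (q := q) (m := m) hc₂ (hmaj₂ (shift q m)) ht
  have hZ := fun m => hasMellin_zetaRayTerm (p := p) (hpos m) hs0
  have hX₁ := fun m => hasMellin_xiRayTerm (p := p) (q := q) (m := m) hc₁
    (fun hm => (hnorm m hm).trans_le (hmaj₁ _)) hs0
  have hX₂ := fun m => hasMellin_xiRayTerm (p := p) (q := q) (m := m) hc₂
    (fun hm => (hnorm m hm).trans_le (hmaj₂ _)) hs0
  have hπ : (Real.pi : ℂ) ≠ 0 := by exact_mod_cast Real.pi_pos.ne'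
  have hsne : s ≠ 0 := fun h => by simp [h] at hs0
  have hZconst : (Real.pi : ℂ) ^ (-s) * Complex.Gamma s ≠ 0 :=
    mul_ne_zero (by simp [Complex.cpow_eq_zero_iff, hπ]) (Complex.Gamma_ne_zero_of_re_pos hs0)
  have hXconst : (Real.pi : ℂ) ^ (-(s + 1 / 2)) * Complex.Gamma (s + 1 / 2) ≠ 0 :=
    mul_ne_zero (by simp [Complex.cpow_eq_zero_iff, hπ])
      (Complex.Gamma_ne_zero_of_re_pos (by simp; linarith))
  -- The Mellin transforms of the terms are summable and equal the zeta summands up to a nonzero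
  -- constant, which can be cancelled.
  have hZsum : Summable (zetaTerm c₁ c₂ p q Ω s) := by
    have h := (hasSum_mellin_of_norm_le_exp q hs zero_le_one hκ
      (fun m => continuous_zetaRayTerm c₁ c₂ p q Ω m)
      (fun m hm t => zetaRayTerm_of_shift_eq_zero c₁ c₂ p Ω hm t)
      (fun m t ht => by rw [one_mul]; exact hZle m t ht)).2.summable
    simp only [fun m => (hZ m).2] at h
    rw [summable_mul_left_iff hZconst, summable_mul_left_iff (by norm_num)] at h
    exact h
  have hXsum : ∀ c : Fin g → ℝ,
      (∀ m t, 0 < t → ‖xiRayTerm c p q Ω m t‖ ≤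
        Real.exp (-(Real.pi * δ * ‖shift q m‖ ^ 2 * t))) →
      (∀ m, HasMellin (xiRayTerm c p q Ω m) s
        ((Real.pi : ℂ) ^ (-(s + 1 / 2)) * Complex.Gamma (s + 1 / 2) *
          (1 / (2 * s) * xiTerm c p q Ω s m))) → Summable (xiTerm c p q Ω s) := by
    intro c hle hX
    have h := (hasSum_mellin_of_norm_le_exp q hs zero_le_one hκ
      (fun m => continuous_xiRayTerm c p q Ω m)
      (fun m hm t => xiRayTerm_of_shift_eq_zero c p Ω hm t)
      (fun m t ht => by rw [one_mul]; exact hle m t ht)).2.summable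
    simp only [fun m => (hX m).2] at h
    rw [summable_mul_left_iff hXconst, summable_mul_left_iff (by simp [hsne])] at h
    exact h
  have hX₁sum := hXsum c₁ hX₁le hX₁
  have hX₂sum := hXsum c₂ hX₂le hX₂
  -- The constant 3 counts the three pieces of a theta term, each bounded by the same exponential.
  obtain ⟨hconv, hsum⟩ := hasSum_mellin_of_norm_le_exp q hs (C := 3) (by norm_num) hκ
    (f := fun m t =>
      zetaRayTerm c₁ c₂ p q Ω m t - (xiRayTerm c₂ p q Ω m t - xiRayTerm c₁ p q Ω m t))
    (fun m => (continuous_zetaRayTerm c₁ c₂ p q Ω m).sub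
      ((continuous_xiRayTerm c₂ p q Ω m).sub (continuous_xiRayTerm c₁ p q Ω m)))
    (fun m hm t => by
      simp [zetaRayTerm_of_shift_eq_zero c₁ c₂ p Ω hm, xiRayTerm_of_shift_eq_zero c₁ p Ω hm,
        xiRayTerm_of_shift_eq_zero c₂ p Ω hm])
    (fun m t ht => by
      have h1 := norm_sub_le (zetaRayTerm c₁ c₂ p q Ω m t)
        (xiRayTerm c₂ p q Ω m t - xiRayTerm c₁ p q Ω m t)
      have h2 := norm_sub_le (xiRayTerm c₂ p q Ω m t) (xiRayTerm c₁ p q Ω m t)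
      linarith [hZle m t ht, hX₁le m t ht, hX₂le m t ht])
  -- The expansion of the theta function is available only for t > 0, which is all that the Mellin
  -- transform sees.
  have hray : Set.EqOn (fun t => ∑' m : Fin g → ℤ,
      (zetaRayTerm c₁ c₂ p q Ω m t - (xiRayTerm c₂ p q Ω m t - xiRayTerm c₁ p q Ω m t)))
      (thetaRay c₁ c₂ p q Ω) (Set.Ioi 0) := fun t ht =>
    (thetaRay_eq_tsum_rayTerms hΩ.1 hc₁ hc₂ p q ht).symm
  have hray' : Set.EqOn (fun t : ℝ => (t : ℂ) ^ (s - 1) • ∑' m : Fin g → ℤ,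
      (zetaRayTerm c₁ c₂ p q Ω m t - (xiRayTerm c₂ p q Ω m t - xiRayTerm c₁ p q Ω m t)))
      (fun t : ℝ => (t : ℂ) ^ (s - 1) • thetaRay c₁ c₂ p q Ω t) (Set.Ioi 0) := fun t ht =>
    congrArg _ (hray ht)
  refine ⟨hpos, hconv.congr_fun hray' measurableSet_Ioi, hZsum, hX₁sum, hX₂sum, ?_⟩
  have hcompleted : completedZeta c₁ c₂ p q Ω s = mellin (fun t => ∑' m : Fin g → ℤ,
      (zetaRayTerm c₁ c₂ p q Ω m t - (xiRayTerm c₂ p q Ω m t - xiRayTerm c₁ p q Ω m t))) s :=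
    (MeasureTheory.setIntegral_congr_fun measurableSet_Ioi hray').symm
  have hterm : ∀ m, mellin (fun t => zetaRayTerm c₁ c₂ p q Ω m t -
      (xiRayTerm c₂ p q Ω m t - xiRayTerm c₁ p q Ω m t)) s =
      (Real.pi : ℂ) ^ (-s) * Complex.Gamma s * (1 / 2 * zetaTerm c₁ c₂ p q Ω s m) -
        ((Real.pi : ℂ) ^ (-(s + 1 / 2)) * Complex.Gamma (s + 1 / 2) *
            (1 / (2 * s) * xiTerm c₂ p q Ω s m) -
          (Real.pi : ℂ) ^ (-(s + 1 / 2)) * Complex.Gamma (s + 1 / 2) *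
            (1 / (2 * s) * xiTerm c₁ p q Ω s m)) := by
    intro m
    have hX := hasMellin_sub (hX₂ m).1 (hX₁ m).1
    rw [(hasMellin_sub (hZ m).1 hX.1).2, hX.2, (hZ m).2, (hX₁ m).2, (hX₂ m).2]
  simp only [hterm] at hsum
  rw [hcompleted, incompleteZeta, xi, xi, mul_sub]
  -- The separate summability of the three series permits splitting the sum of the termwise
  -- transforms.
  exact hsum.unique (((hZsum.hasSum.mul_left _).mul_left _).sub
    (((hX₂sum.hasSum.mul_left _).mul_left _).sub ((hX₁sum.hasSum.mul_left _).mul_left _)))
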